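/- Let $\mathcal H$ be a complex Hilbert space, $A$ a (possibly unbounded) self-adjoint operator on $\mathcal H$ with domain $\mathcal D(A)$, and $\langle A\rangle=\sqrt{A^2+1}$; for $m\in\mathbb Z$ put $\langle m\rangle=\sqrt{m^2+1}$. A bounded operator $B$ on $\mathcal H$ is of class $C^1(A)$ if the form $(\varphi,\psi)\mapsto\langle A\varphi,B\psi\rangle-\langle\varphi,BA\psi\rangle$ on $\mathcal D(A)\times\mathcal D(A)$ extends to a bounded form on $\mathcal H\times\mathcal H$; the bounded operator associated with the extension is denoted $\mathrm{ad}_A B$. For $k\in\mathbb N$, $B\in C^k(A)$ means that $\mathrm{ad}_A^{\,j}B\in C^1(A)$ for all $0\le j<k$ (with $\mathrm{ad}_A^0B=B$), and $B\in C^\infty(A)$ means $B\in C^k(A)$ for all $k$. Let $U$ be a unitary operator on $\mathcal H$ with spectral family $(E_\Delta)$, indexed by the Borel subsets $\Delta$ of the unit circle $\mathbb S\cong\mathbb T$, and let $\sigma_{pp}(U)\subset\mathbb S$ be its set of eigenvalues. If $U\in C^1(A)$, write $U^*AU-A$ for the bounded operator $U^*(\mathrm{ad}_AU)$. One says that $U$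 is propagating with respect to $A$ on a Borel set $\Theta\subset\mathbb S$ if $U\in C^1(A)$ and there are $c>0$ and a compact operator $K$ such that $E_\Theta(U^*AU-A)E_\Theta\ge cE_\Theta+K$. **Corollary.** Let $\Theta\subset\mathbb S$ be open. Assume that $U\in C^\infty(A)$, that $U$ is propagating with respect to $A$ on $\Theta$, and that $\Phi\in C_0^\infty(\Theta\setminus\sigma_{pp}(U))$, i.e. $\Phi:\mathbb S\to\mathbb C$ is smooth and its support is contained in $\Theta\setminus\sigma_{pp}(U)$. Then for all real $0<s'<s$ there exists $C>0$ such that for all $m\in\mathbb Z$ $$\big\|\langle A\rangle^{-s}\,U^m\,\Phi(U)\,\langle A\rangle^{-s}\big\|\le C\,\langle m\rangle^{-s'} .$$ -/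

import Mathlib

open scoped InnerProductSpace CompactlySupported ContDiff

noncomputable section

namespace UnitaryMourre

variable {H : Type*} [NormedAddCommGroup H] [InnerProductSpace ℂ H] [CompleteSpace H]

/-! ### Continuous functional calculus and spectral family of a unitary operator -/

/-- The inclusion of the spectrum of the unitary operator `U` into the unit circle. -/
def spectrumToCircle (U : unitary (H →L[ℂ] H)) : C(spectrum ℂ (U : H →L[ℂ] H), Circle) where
  toFun z := ⟨z.1, mem_sphere_zero_iff_norm.mpr
    (spectrum.norm_eq_one_of_unitary (𝕜 := ℂ) U.2 z.2)⟩
  continuous_toFun := Continuous.subtype_mk continuous_subtype_val _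

/-- The functional calculus `Φ ↦ Φ(U)` for continuous functions `Φ` on the unit circle. -/
def funCalc (U : unitary (H →L[ℂ] H)) : C(Circle, ℂ) →⋆ₐ[ℂ] (H →L[ℂ] H) :=
  (cfcHom (R := ℂ) (a := (U : H →L[ℂ] H)) (inferInstanceAs (IsStarNormal (U : H →L[ℂ] H)))).comp
    (ContinuousMap.compStarAlgHom' ℂ ℂ (spectrumToCircle U))

/-- A real continuous function on the circle, seen as a complex one. -/
def toComplexFun (f : C_c(Circle, ℝ)) : C(Circle, ℂ) where
  toFun z := (f z : ℂ)
  continuous_toFun := Complex.continuous_ofReal.comp f.continuous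


/-- The positive functional `f ↦ ⟪ψ, f(U) ψ⟫`. -/
def spectralFunctional (U : unitary (H →L[ℂ] H)) (ψ : H) : C_c(Circle, ℝ) →ₚ[ℝ] ℝ :=
  PositiveLinearMap.mk₀
    { toFun := fun f => (⟪ψ, funCalc U (toComplexFun f) ψ⟫_ℂ).re
      map_add' := by
        intro f g
        have : toComplexFun (f + g) = toComplexFun f + toComplexFun g := by
          ext z; simp [toComplexFun]
        rw [this, map_add]
        simp
      map_smul' := by
        intro c f
        have : toComplexFun (c • f) = (c : ℂ) • toComplexFun f := by
          ext z; simp [toComplexFun]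
        rw [this, map_smul]
        simp }
    (by
      intro f hf
      let g : C(Circle, ℂ) :=
        ⟨fun z => (Real.sqrt (f z) : ℂ),
          Complex.continuous_ofReal.comp (Real.continuous_sqrt.comp f.continuous)⟩
      have hg : toComplexFun f = star g * g := by
        ext z
        have h0 : (0 : ℝ) ≤ f z := hf z
        simp only [toComplexFun, g, ContinuousMap.mul_apply, ContinuousMap.star_apply,
          ContinuousMap.coe_mk, RCLike.star_def, Complex.conj_ofReal]
        rw [← Complex.ofReal_mul, Real.mul_self_sqrt h0]
      change 0 ≤ (⟪ψ, funCalc U (toComplexFun f) ψ⟫_ℂ).re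
      rw [hg, map_mul, map_star, ContinuousLinearMap.star_eq_adjoint,
        mul_apply_eq_comp, ContinuousLinearMap.adjoint_inner_right]
      exact inner_self_nonneg (𝕜 := ℂ))

instance instMeasurableSpaceCircle : MeasurableSpace Circle := borel Circle

instance instBorelSpaceCircle : BorelSpace Circle := ⟨rfl⟩

/-- The scalar spectral measure of `U` at `ψ`: the measure on the circle that represents
`f ↦ ⟪ψ, f(U) ψ⟫`. -/
def spectralMeasure (U : unitary (H →L[ℂ] H)) (ψ : H) : MeasureTheory.Measure Circle :=
  RealRMK.rieszMeasure (spectralFunctional U ψ)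

instance instIsFiniteMeasureSpectralMeasure (U : unitary (H →L[ℂ] H)) (ψ : H) :
    MeasureTheory.IsFiniteMeasure (spectralMeasure U ψ) := by
  unfold spectralMeasure; infer_instance

theorem spectralFunctional_apply (U : unitary (H →L[ℂ] H)) (ψ : H) (f : C_c(Circle, ℝ)) :
    spectralFunctional U ψ f = (⟪ψ, funCalc U (toComplexFun f) ψ⟫_ℂ).re := rfl

theorem integral_spectralMeasure (U : unitary (H →L[ℂ] H)) (ψ : H) (f : C_c(Circle, ℝ)) :
    ∫ z, f z ∂(spectralMeasure U ψ) = (⟪ψ, funCalc U (toComplexFun f) ψ⟫_ℂ).re :=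
  RealRMK.integral_rieszMeasure (spectralFunctional U ψ) f

/-- A linear relation between the functionals `f ↦ ⟪ψ, f(U) ψ⟫` passes to the measures. -/
theorem spectralMeasure_relation (U : unitary (H →L[ℂ] H)) {ι : Type*} [Fintype ι]
    (c : ι → ℝ) (v : ι → H)
    (h : ∀ f : C_c(Circle, ℝ), ∑ i, c i * (⟪v i, funCalc U (toComplexFun f) (v i)⟫_ℂ).re = 0)
    (Δ : Set Circle) :
    ∑ i, c i * (spectralMeasure U (v i)).real Δ = 0 := by
  let P : MeasureTheory.Measure Circle := ∑ i, (c i).toNNReal • spectralMeasure U (v i)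
  let N : MeasureTheory.Measure Circle := ∑ i, (-c i).toNNReal • spectralMeasure U (v i)
  have hint : ∀ (d : ι → NNReal) (f : C_c(Circle, ℝ)),
      ∫ z, f z ∂(∑ i, d i • spectralMeasure U (v i)) =
        ∑ i, (d i : ℝ) * (⟪v i, funCalc U (toComplexFun f) (v i)⟫_ℂ).re := by
    intro d f
    rw [MeasureTheory.integral_finsetSum_measure (fun i _ => f.integrable)]
    refine Finset.sum_congr rfl fun i _ => ?_
    rw [MeasureTheory.integral_smul_nnreal_measure, integral_spectralMeasure]
    rfl
  have hreal : ∀ (d : ι → NNReal), (∑ i, d i • spectralMeasure U (v i)).real Δ =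
        ∑ i, (d i : ℝ) * (spectralMeasure U (v i)).real Δ := by
    intro d
    rw [MeasureTheory.measureReal_def, MeasureTheory.Measure.finsetSum_apply,
      ENNReal.toReal_sum (fun i _ => by finiteness)]
    refine Finset.sum_congr rfl fun i _ => ?_
    simp [MeasureTheory.measureReal_def]
  have hd : ∀ i, c i = ((c i).toNNReal : ℝ) - ((-c i).toNNReal : ℝ) := by
    intro i
    rw [Real.coe_toNNReal', Real.coe_toNNReal']
    exact (max_zero_sub_max_neg_zero_eq_self (c i)).symm
  have hPN : P = N := by
    refine MeasureTheory.Measure.ext_of_integral_eq_on_compactlySupported fun f => ?_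
    rw [hint, hint, ← sub_eq_zero, ← Finset.sum_sub_distrib, ← h f]
    refine Finset.sum_congr rfl fun i _ => ?_
    rw [← sub_mul, ← hd]
  have h2 : P.real Δ = N.real Δ := by rw [hPN]
  rw [hreal, hreal, ← sub_eq_zero, ← Finset.sum_sub_distrib] at h2
  rw [← h2]
  refine Finset.sum_congr rfl fun i _ => ?_
  rw [← sub_mul, ← hd]

/-- Real polarization of `ψ ↦ μ_ψ(Δ)`. -/
def polar (U : unitary (H →L[ℂ] H)) (Δ : Set Circle) (φ ψ : H) : ℝ :=
  ((spectralMeasure U (φ + ψ)).real Δ - (spectralMeasure U (φ - ψ)).real Δ) / 4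

theorem inner_funCalc_symm (U : unitary (H →L[ℂ] H)) (f : C_c(Circle, ℝ)) (φ ψ : H) :
    (⟪ψ, funCalc U (toComplexFun f) φ⟫_ℂ).re = (⟪φ, funCalc U (toComplexFun f) ψ⟫_ℂ).re := by
  have hs : star (toComplexFun f) = toComplexFun f := by
    ext z; simp [toComplexFun]
  have h1 : ContinuousLinearMap.adjoint (funCalc U (toComplexFun f)) =
      funCalc U (toComplexFun f) := by
    rw [← ContinuousLinearMap.star_eq_adjoint, ← map_star, hs]
  rw [← ContinuousLinearMap.adjoint_inner_left, h1, ← inner_conj_symm, Complex.conj_re]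

theorem polar_relation (U : unitary (H →L[ℂ] H)) {ι : Type*} [Fintype ι]
    (c : ι → ℝ) (v w : ι → H)
    (h : ∀ f : C_c(Circle, ℝ), ∑ i, c i * (⟪v i, funCalc U (toComplexFun f) (w i)⟫_ℂ).re = 0)
    (Δ : Set Circle) :
    ∑ i, c i * polar U Δ (v i) (w i) = 0 := by
  have key := spectralMeasure_relation U (Sum.elim (fun i => c i / 4) (fun i => -c i / 4))
    (Sum.elim (fun i => v i + w i) (fun i => v i - w i)) (by
      intro f
      rw [← h f, Fintype.sum_sum_type, ← Finset.sum_add_distrib]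
      refine Finset.sum_congr rfl fun i _ => ?_
      simp only [Sum.elim_inl, Sum.elim_inr, map_add, map_sub, inner_add_left, inner_add_right,
        inner_sub_left, inner_sub_right, Complex.add_re, Complex.sub_re]
      rw [inner_funCalc_symm U f (v i) (w i)]
      ring) Δ
  rw [← key, Fintype.sum_sum_type, ← Finset.sum_add_distrib]
  refine Finset.sum_congr rfl fun i _ => ?_
  simp only [Sum.elim_inl, Sum.elim_inr, polar]
  ring

theorem polar_comm (U : unitary (H →L[ℂ] H)) (Δ : Set Circle) (φ ψ : H) :
    polar U Δ φ ψ = polar U Δ ψ φ := by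
  have := polar_relation U ![1, -1] ![φ, ψ] ![ψ, φ] (by
    intro f
    simp [Fin.sum_univ_two, inner_funCalc_symm U f φ ψ]) Δ
  simp [Fin.sum_univ_two] at this
  linarith

theorem polar_add_right (U : unitary (H →L[ℂ] H)) (Δ : Set Circle) (φ ψ χ : H) :
    polar U Δ φ (ψ + χ) = polar U Δ φ ψ + polar U Δ φ χ := by
  have := polar_relation U ![1, -1, -1] ![φ, φ, φ] ![ψ + χ, ψ, χ] (by
    intro f
    simp [Fin.sum_univ_three]) Δ
  simp [Fin.sum_univ_three] at this
  linarith

theorem polar_smul_right (U : unitary (H →L[ℂ] H)) (Δ : Set Circle) (c : ℂ) (φ ψ : H) :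
    polar U Δ φ (c • ψ) = c.re * polar U Δ φ ψ + c.im * polar U Δ φ (Complex.I • ψ) := by
  have := polar_relation U ![1, -c.re, -c.im] ![φ, φ, φ] ![c • ψ, ψ, Complex.I • ψ] (by
    intro f
    simp [Fin.sum_univ_three]
    ring) Δ
  simp [Fin.sum_univ_three] at this
  linarith

theorem polar_I_left (U : unitary (H →L[ℂ] H)) (Δ : Set Circle) (φ ψ : H) :
    polar U Δ (Complex.I • φ) ψ = - polar U Δ φ (Complex.I • ψ) := by
  have := polar_relation U ![1, 1] ![Complex.I • φ, φ] ![ψ, Complex.I • ψ] (by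
    intro f
    simp [Fin.sum_univ_two]) Δ
  simp [Fin.sum_univ_two] at this
  linarith

theorem polar_self (U : unitary (H →L[ℂ] H)) (Δ : Set Circle) (ψ : H) :
    polar U Δ ψ ψ = (spectralMeasure U ψ).real Δ := by
  have := spectralMeasure_relation U ![1, -1, -4] ![ψ + ψ, ψ - ψ, ψ] (by
    intro f
    simp [Fin.sum_univ_three]
    ring) Δ
  simp [Fin.sum_univ_three] at this
  simp [polar]
  linarith

theorem polar_self_I (U : unitary (H →L[ℂ] H)) (Δ : Set Circle) (ψ : H) :
    polar U Δ ψ (Complex.I • ψ) = 0 := by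
  have h1 := polar_I_left U Δ ψ ψ
  rw [polar_comm] at h1
  linarith

theorem spectralMeasure_real_le (U : unitary (H →L[ℂ] H)) (Δ : Set Circle) (ψ : H) :
    (spectralMeasure U ψ).real Δ ≤ ‖ψ‖ ^ 2 := by
  refine (MeasureTheory.measureReal_mono (Set.subset_univ Δ)).trans (le_of_eq ?_)
  let o : C_c(Circle, ℝ) := ⟨1, HasCompactSupport.of_compactSpace 1⟩
  have h1 := integral_spectralMeasure U ψ o
  have h2 : toComplexFun o = 1 := by
    ext z
    exact Complex.ofReal_one
  have h3 : ∀ z, o z = 1 := fun z => rfl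
  rw [h2, map_one] at h1
  simp only [h3, MeasureTheory.integral_const, smul_eq_mul, mul_one] at h1
  rw [h1, one_apply_eq_self]
  exact inner_self_eq_norm_sq (𝕜 := ℂ) ψ

theorem abs_polar_le (U : unitary (H →L[ℂ] H)) (Δ : Set Circle) (φ ψ : H) :
    |polar U Δ φ ψ| ≤ ‖φ‖ * ‖ψ‖ := by
  have hq : ∀ φ ψ : H, |polar U Δ φ ψ| ≤ (‖φ‖ ^ 2 + ‖ψ‖ ^ 2) / 2 := by
    intro φ ψ
    have h1 := spectralMeasure_real_le U Δ (φ + ψ)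
    have h2 := spectralMeasure_real_le U Δ (φ - ψ)
    have h3 : 0 ≤ (spectralMeasure U (φ + ψ)).real Δ := MeasureTheory.measureReal_nonneg
    have h4 : 0 ≤ (spectralMeasure U (φ - ψ)).real Δ := MeasureTheory.measureReal_nonneg
    have h5 := parallelogram_law_with_norm ℂ φ ψ
    rw [polar, abs_le]
    constructor <;> nlinarith
  have hs : ∀ (r t : ℝ) (φ ψ : H),
      polar U Δ ((r : ℂ) • φ) ((t : ℂ) • ψ) = r * t * polar U Δ φ ψ := by
    intro r t φ ψ
    rw [polar_smul_right, polar_comm U Δ ((r : ℂ) • φ) ψ, polar_smul_right, polar_comm U Δ ψ φ]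
    simp
    ring
  rcases eq_or_ne φ 0 with rfl | hφ
  · have := hs 0 1 0 ψ
    simp at this
    simp [this]
  rcases eq_or_ne ψ 0 with rfl | hψ
  · have := hs 1 0 φ 0
    simp at this
    simp [this]
  have hφ' : 0 < ‖φ‖ := norm_pos_iff.mpr hφ
  have hψ' : 0 < ‖ψ‖ := norm_pos_iff.mpr hψ
  have h1 := hq (((‖φ‖⁻¹ : ℝ) : ℂ) • φ) (((‖ψ‖⁻¹ : ℝ) : ℂ) • ψ)
  rw [hs, norm_smul, norm_smul, Complex.norm_real, Complex.norm_real, norm_inv, norm_inv,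
    norm_norm, norm_norm, inv_mul_cancel₀ hφ'.ne', inv_mul_cancel₀ hψ'.ne', abs_mul, abs_mul,
    abs_of_pos (inv_pos.mpr hφ'), abs_of_pos (inv_pos.mpr hψ'), ← mul_inv] at h1
  rw [inv_mul_le_iff₀ (by positivity)] at h1
  linarith

/-- For every Borel set `Δ` there is a bounded operator whose quadratic form is
`ψ ↦ μ_ψ(Δ)`. -/
theorem exists_spectralProj (U : unitary (H →L[ℂ] H)) (Δ : Set Circle) :
    ∃ E : H →L[ℂ] H, ∀ ψ : H, ⟪ψ, E ψ⟫_ℂ = ((spectralMeasure U ψ).real Δ : ℂ) := by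
  have hadd : ∀ φ χ ψ, polar U Δ (φ + χ) ψ = polar U Δ φ ψ + polar U Δ χ ψ := by
    intro φ χ ψ
    rw [polar_comm, polar_add_right, polar_comm U Δ ψ φ, polar_comm U Δ ψ χ]
  have hII : ∀ φ ψ, polar U Δ φ (Complex.I • Complex.I • ψ) = - polar U Δ φ ψ := by
    intro φ ψ
    have h : Complex.I • Complex.I • ψ = (-1 : ℂ) • ψ := by rw [smul_smul, Complex.I_mul_I]
    rw [h, polar_smul_right]
    simp
  let B : H →ₗ⋆[ℂ] H →ₗ[ℂ] ℂ := LinearMap.mk₂'ₛₗ (starRingEnd ℂ) (RingHom.id ℂ)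
    (fun φ ψ => (polar U Δ φ ψ : ℂ) - Complex.I * (polar U Δ φ (Complex.I • ψ) : ℂ))
    (by
      intro φ χ ψ
      rw [hadd, hadd]; push_cast; ring)
    (by
      intro c φ ψ
      have hl : ∀ χ, polar U Δ (c • φ) χ =
          c.re * polar U Δ φ χ - c.im * polar U Δ φ (Complex.I • χ) := by
        intro χ
        rw [polar_comm, polar_smul_right, polar_comm U Δ χ φ,
          polar_comm U Δ χ (Complex.I • φ), polar_I_left]
        ring
      rw [hl, hl, hII]
      apply Complex.ext <;> simp <;> ring)
    (by
      intro φ ψ χ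
      rw [smul_add, polar_add_right, polar_add_right]; push_cast; ring)
    (by
      intro c φ ψ
      rw [smul_comm Complex.I c ψ, polar_smul_right, polar_smul_right U Δ c φ (Complex.I • ψ), hII]
      apply Complex.ext <;> simp <;> ring)
  have hB : ∀ φ ψ, ‖B φ ψ‖ ≤ 2 * ‖φ‖ * ‖ψ‖ := by
    intro φ ψ
    change ‖(polar U Δ φ ψ : ℂ) - Complex.I * (polar U Δ φ (Complex.I • ψ) : ℂ)‖ ≤ _
    refine (norm_sub_le _ _).trans ?_
    rw [norm_mul, Complex.norm_I, one_mul, Complex.norm_real, Complex.norm_real,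
      Real.norm_eq_abs, Real.norm_eq_abs]
    have h1 := abs_polar_le U Δ φ ψ
    have h2 := abs_polar_le U Δ φ (Complex.I • ψ)
    rw [norm_smul, Complex.norm_I, one_mul] at h2
    linarith
  let E' := InnerProductSpace.continuousLinearMapOfBilin (B.mkContinuous₂ 2 hB)
  refine ⟨E', fun ψ => ?_⟩
  have h1 : ⟪E' ψ, ψ⟫_ℂ = B ψ ψ := InnerProductSpace.continuousLinearMapOfBilin_apply _ ψ ψ
  have h2 : B ψ ψ = ((spectralMeasure U ψ).real Δ : ℂ) := by
    change (polar U Δ ψ ψ : ℂ) - Complex.I * (polar U Δ ψ (Complex.I • ψ) : ℂ) = _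
    rw [polar_self_I, polar_self]; simp
  rw [← inner_conj_symm, h1, h2, Complex.conj_ofReal]

/-- The spectral projection `E_Δ` of `U`: the operator with `⟪ψ, E_Δ ψ⟫ = μ_ψ(Δ)` for all `ψ`,
where `μ_ψ` is the scalar spectral measure of `U` at `ψ`. -/
def spectralProj (U : unitary (H →L[ℂ] H)) (Δ : Set Circle) : H →L[ℂ] H :=
  Classical.choose (exists_spectralProj U Δ)

theorem inner_spectralProj (U : unitary (H →L[ℂ] H)) (Δ : Set Circle) (ψ : H) :
    ⟪ψ, spectralProj U Δ ψ⟫_ℂ = ((spectralMeasure U ψ).real Δ : ℂ) :=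
  Classical.choose_spec (exists_spectralProj U Δ) ψ

/-- The set `σ_pp(U)` of eigenvalues of `U`, as a subset of the circle. -/
def pointSpectrum (U : unitary (H →L[ℂ] H)) : Set Circle :=
  {z | Module.End.HasEigenvalue ((U : H →L[ℂ] H) : H →ₗ[ℂ] H) (z : ℂ)}

/-! ### Negative powers of `⟨A⟩` for a self-adjoint operator `A` -/

/-- `R` is the bounded inverse `(A² + 1)⁻¹`: it maps into the domain of `A²` and
`(A² + 1) R = 1`, `R (A² + 1) = 1`. -/
def IsInvSqAddOne (A : H →ₗ.[ℂ] H) (R : H →L[ℂ] H) : Prop :=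
  (∀ y : H, ∃ (h₁ : R y ∈ A.domain) (h₂ : A ⟨R y, h₁⟩ ∈ A.domain), A ⟨_, h₂⟩ + R y = y) ∧
  ∀ (x : A.domain) (h : A x ∈ A.domain), R (A ⟨A x, h⟩ + x) = x

theorem exists_isInvSqAddOne {A : H →ₗ.[ℂ] H} (hA : IsSelfAdjoint A) :
    ∃ R : H →L[ℂ] H, IsInvSqAddOne A R := by
  have hd := hA.dense_domain
  have hAA : A.adjoint = A := LinearPMap.isSelfAdjoint_def.mp hA
  have hsymm : ∀ x y : A.domain, ⟪A x, (y : H)⟫_ℂ = ⟪(x : H), A y⟫_ℂ := by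
    have h := LinearPMap.adjoint_isFormalAdjoint (T := A) hd
    rw [hAA] at h
    exact fun x y => h x y
  have hmem : ∀ (y w : H), (∀ x : A.domain, ⟪w, (x : H)⟫_ℂ = ⟪y, A x⟫_ℂ) →
      ∃ hy : y ∈ A.domain, A ⟨y, hy⟩ = w := by
    intro y w h
    have hy : y ∈ A.adjoint.domain := LinearPMap.mem_adjoint_domain_of_exists y ⟨w, h⟩
    have hw := LinearPMap.adjoint_apply_eq hd ⟨y, hy⟩ h
    have aux : ∀ T : H →ₗ.[ℂ] H, T = A → ∀ h' : y ∈ T.domain, T ⟨y, h'⟩ = w →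
        ∃ hy : y ∈ A.domain, A ⟨y, hy⟩ = w := by
      rintro T rfl h' hw; exact ⟨h', hw⟩
    exact aux _ hAA hy hw
  -- the graph of `A`, as a closed subspace of the Hilbert space `H ⊕ H`
  let e : WithLp 2 (H × H) ≃L[ℂ] H × H := WithLp.prodContinuousLinearEquiv 2 ℂ H H
  let G : Submodule ℂ (WithLp 2 (H × H)) := A.graph.comap (e : WithLp 2 (H × H) →ₗ[ℂ] H × H)
  have hGc : IsClosed (G : Set (WithLp 2 (H × H))) := by
    have : IsClosed (A.graph : Set (H × H)) := hA.isClosed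
    exact this.preimage e.continuous
  have : CompleteSpace G := hGc.completeSpace_coe
  let R : H →L[ℂ] H := (ContinuousLinearMap.fst ℂ H H).comp
    ((e : WithLp 2 (H × H) →L[ℂ] H × H).comp (G.starProjection.comp
      ((e.symm : H × H →L[ℂ] WithLp 2 (H × H)).comp (ContinuousLinearMap.inl ℂ H H))))
  have hright : ∀ y : H, ∃ (h₁ : R y ∈ A.domain) (h₂ : A ⟨R y, h₁⟩ ∈ A.domain),
      A ⟨_, h₂⟩ + R y = y := by
    intro y
    set p : WithLp 2 (H × H) := G.starProjection (e.symm (y, 0)) with hp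
    have hpG : e p ∈ A.graph := G.starProjection_apply_mem _
    have hR : R y = (e p).1 := rfl
    obtain ⟨x, hx1, hx2⟩ := (LinearPMap.mem_graph_iff A).mp hpG
    have hperp : ∀ z : A.domain, ⟪y - (x : H), (z : H)⟫_ℂ = ⟪A x, A z⟫_ℂ := by
      intro z
      have hz : e.symm ((z : H), A z) ∈ G := by
        change e (e.symm ((z : H), A z)) ∈ A.graph
        rw [ContinuousLinearEquiv.apply_symm_apply]
        exact A.mem_graph z
      have h := G.starProjection_inner_eq_zero (e.symm (y, 0)) _ hz
      rw [← hp, WithLp.prod_inner_apply] at h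
      have h' : ⟪y - (e p).1, (z : H)⟫_ℂ + ⟪0 - (e p).2, A z⟫_ℂ = 0 := h
      rw [← hx1, ← hx2, zero_sub, inner_neg_left] at h'
      exact add_neg_eq_zero.mp h'
    obtain ⟨h₂, h₃⟩ := hmem (A x) (y - x) hperp
    have hRx : R y = x := by rw [hR, hx1]
    have h₁ : R y ∈ A.domain := by rw [hRx]; exact x.2
    have hxe : (⟨R y, h₁⟩ : A.domain) = x := Subtype.ext hRx
    refine ⟨h₁, by rw [hxe]; exact h₂, ?_⟩
    have : ∀ (x' : A.domain) (h : A x' ∈ A.domain), x' = x → A ⟨A x', h⟩ = y - x := by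
      rintro x' h rfl; exact h₃
    rw [this _ _ hxe, hRx]
    simp
  have hinj : ∀ (x : A.domain) (h : A x ∈ A.domain), A ⟨A x, h⟩ + x = 0 → (x : H) = 0 := by
    intro x h h0
    have h1 : ⟪A ⟨A x, h⟩ + (x : H), (x : H)⟫_ℂ = 0 := by rw [h0, inner_zero_left]
    rw [inner_add_left, hsymm] at h1
    have h2 := congrArg Complex.re h1
    have h3 : 0 ≤ (⟪A x, A x⟫_ℂ).re := inner_self_nonneg (𝕜 := ℂ)
    have h4 : (⟪(x : H), (x : H)⟫_ℂ).re = ‖(x : H)‖ ^ 2 := inner_self_eq_norm_sq (𝕜 := ℂ) _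
    simp only [Complex.add_re, Complex.zero_re] at h2
    have h5 : ‖(x : H)‖ ^ 2 ≤ 0 := by rw [← h4]; linarith
    exact norm_eq_zero.mp (pow_eq_zero_iff (two_ne_zero) |>.mp (le_antisymm h5 (by positivity)))
  refine ⟨R, hright, fun x h => ?_⟩
  obtain ⟨h₁, h₂, h₃⟩ := hright (A ⟨A x, h⟩ + x)
  set y : A.domain := ⟨_, h₁⟩ with hy
  have hsub : A (y - x) = A y - A x := A.map_sub y x
  have hm : A (y - x) ∈ A.domain := by rw [hsub]; exact A.domain.sub_mem h₂ h
  have h6 : A ⟨A (y - x), hm⟩ = A ⟨A y, h₂⟩ - A ⟨A x, h⟩ := by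
    rw [← LinearPMap.map_sub]
    congr 1
    exact Subtype.ext hsub
  have h7 := hinj (y - x) hm (by
    rw [h6, Submodule.coe_sub, sub_add_sub_comm, sub_eq_zero]
    exact h₃)
  exact sub_eq_zero.mp h7

open Classical in
/-- The bounded operator `(A² + 1)⁻¹` of a self-adjoint operator `A`. -/
def invSqAddOne (A : H →ₗ.[ℂ] H) : H →L[ℂ] H :=
  if h : ∃ R : H →L[ℂ] H, IsInvSqAddOne A R then Classical.choose h else 0

theorem invSqAddOne_spec {A : H →ₗ.[ℂ] H} (hA : IsSelfAdjoint A) :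
    IsInvSqAddOne A (invSqAddOne A) := by
  unfold invSqAddOne
  rw [dif_pos (exists_isInvSqAddOne hA)]
  exact Classical.choose_spec (exists_isInvSqAddOne hA)

theorem invSqAddOne_nonneg {A : H →ₗ.[ℂ] H} (hA : IsSelfAdjoint A) : 0 ≤ invSqAddOne A := by
  have hd := hA.dense_domain
  have hsymm : ∀ x y : A.domain, ⟪A x, (y : H)⟫_ℂ = ⟪(x : H), A y⟫_ℂ := by
    have h := LinearPMap.adjoint_isFormalAdjoint (T := A) hd
    rw [LinearPMap.isSelfAdjoint_def.mp hA] at h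
    exact fun x y => h x y
  rw [ContinuousLinearMap.nonneg_iff_isPositive, ContinuousLinearMap.isPositive_iff_complex]
  intro y
  obtain ⟨h₁, h₂, h₃⟩ := (invSqAddOne_spec hA).1 y
  set x : A.domain := ⟨invSqAddOne A y, h₁⟩ with hx
  have hy : y = A ⟨A x, h₂⟩ + x := h₃.symm
  have key : ⟪(x : H), y⟫_ℂ = ((‖A x‖ ^ 2 + ‖(x : H)‖ ^ 2 : ℝ) : ℂ) := by
    have h4 : ⟪(x : H), A ⟨A x, h₂⟩⟫_ℂ = ⟪A x, A x⟫_ℂ := (hsymm x ⟨A x, h₂⟩).symm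
    calc ⟪(x : H), y⟫_ℂ = ⟪(x : H), A ⟨A x, h₂⟩ + x⟫_ℂ := congrArg _ hy
      _ = _ := by
        rw [inner_add_right, h4, inner_self_eq_norm_sq_to_K, inner_self_eq_norm_sq_to_K]
        push_cast
        rfl
  change ((⟪(x : H), y⟫_ℂ).re : ℂ) = ⟪(x : H), y⟫_ℂ ∧ 0 ≤ (⟪(x : H), y⟫_ℂ).re
  rw [key, Complex.ofReal_re]
  exact ⟨rfl, by positivity⟩

/-- `⟨A⟩ ^ (-s) = ((A² + 1)⁻¹) ^ (s / 2)` for `s > 0`, where `⟨A⟩ = √(A² + 1)`. -/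
def bracketNegPow (A : H →ₗ.[ℂ] H) (s : ℝ) : H →L[ℂ] H :=
  CFC.rpow (invSqAddOne A) (s / 2)

/-- `⟨m⟩ = √(m² + 1)`. -/
def bracket (m : ℤ) : ℝ := Real.sqrt ((m : ℝ) ^ 2 + 1)

/-! ### Commutators, regularity classes and propagation -/

/-- `C` is the bounded operator associated with the form
`(φ, ψ) ↦ ⟪A φ, B ψ⟫ - ⟪φ, B A ψ⟫` on the domain of `A`. -/
def IsCommutator (A : H →ₗ.[ℂ] H) (B C : H →L[ℂ] H) : Prop :=
  ∀ φ ψ : A.domain, ⟪A φ, B ψ⟫_ℂ - ⟪(φ : H), B (A ψ)⟫_ℂ = ⟪(φ : H), C ψ⟫_ℂ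

/-- `B ∈ C¹(A)`. -/
def IsC1 (A : H →ₗ.[ℂ] H) (B : H →L[ℂ] H) : Prop := ∃ C : H →L[ℂ] H, IsCommutator A B C

open Classical in
/-- The commutator `ad_A B = [A, B]` of `B ∈ C¹(A)` (and `0` if `B ∉ C¹(A)`). -/
def ad (A : H →ₗ.[ℂ] H) (B : H →L[ℂ] H) : H →L[ℂ] H :=
  if h : IsC1 A B then Classical.choose h else 0

/-- `B ∈ C^k(A)`: the iterated commutators `ad_A^j B`, `j < k`, are all of class `C¹(A)`. -/
def IsCk (A : H →ₗ.[ℂ] H) (k : ℕ) (B : H →L[ℂ] H) : Prop :=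
  ∀ j < k, IsC1 A ((ad A)^[j] B)

/-- `B ∈ C^∞(A)`. -/
def IsCinfty (A : H →ₗ.[ℂ] H) (B : H →L[ℂ] H) : Prop := ∀ k : ℕ, IsCk A k B

/-- `U` is propagating with respect to `A` on `Θ`: `U ∈ C¹(A)` and
`E_Θ (U* A U - A) E_Θ ≥ c E_Θ + K` for some `c > 0` and some compact operator `K`, where
`U* A U - A` stands for the bounded operator `U* (ad_A U)`. -/
def IsPropagating (A : H →ₗ.[ℂ] H) (U : unitary (H →L[ℂ] H)) (Θ : Set Circle) : Prop :=
  IsC1 A (U : H →L[ℂ] H) ∧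
  ∃ c : ℝ, 0 < c ∧ ∃ K : H →L[ℂ] H, IsCompactOperator K ∧
    (c : ℂ) • spectralProj U Θ + K ≤
      spectralProj U Θ * (star (U : H →L[ℂ] H) * ad A (U : H →L[ℂ] H)) * spectralProj U Θ

/-- `Φ` is a smooth function on the circle whose (compact) support lies in `S`. -/
def IsSmoothWithSupportIn (Φ : C(Circle, ℂ)) (S : Set Circle) : Prop :=
  ContDiff ℝ ∞ (fun θ : ℝ => Φ (Circle.exp θ)) ∧ tsupport Φ ⊆ S

end UnitaryMourre

end

open scoped InnerProductSpace CompactlySupported ContDiff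

noncomputable section

set_option linter.unusedSectionVars false

namespace UnitaryMourre

variable {H : Type*} [NormedAddCommGroup H] [InnerProductSpace ℂ H] [CompleteSpace H]

/-! ### Commutators of bounded operators with a self-adjoint operator -/

section Commutator

variable {A : H →ₗ.[ℂ] H}

/-! The decay comes from deforming U in a non-unitary direction. For B in C^∞(A), consider the
formal curve B(ε) = e^{-εA} B e^{εA} with real ε. Its Taylor coefficients (-1)^j ad_A^j B / j! are
bounded, and with exact exponentials ⟪e^{εA} x, B(ε) e^{-εA} y⟫ would not depend on ε. At ε = 0 this
pairing is the matrix element to be estimated, while at ε > 0 the deformed operator can be a strict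
contraction, whose m-th power is exponentially small in m.

Since e^{±εA} is unbounded, everything is truncated. The operators are replaced by Taylor
polynomials of order 2n, and the exponentials, applied to (A² + 1)⁻ⁿ, by sums of the bounded
operators A^i (A² + 1)⁻ⁿ. The pairing is then constant up to an error of size (ε^{2n-1} + m ε^{2n})
e^{-cεm}, whose integral over ε is O(m^{-2n}) (`exists_norm_pairing_le`). This bounds ⟨A⟩^{-2n} U^m
Φ(U) ⟨A⟩^{-2n} by a multiple of m^{-2n}.

Contractivity is where propagation enters. Near a point of Θ that is not an eigenvalue, the compact
remainder becomes small after multiplication by a narrow spectral cutoff χ(U), so the commutator is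
positive there up to a small multiple of ‖φ‖². The deformation of U χ(U), rather than of U, then has
norm at most 1 - cε/4 for small ε (`exists_norm_truncEval_le`). If χΦ = Φ, then (U χ(U))^m Φ(U) =
U^m Φ(U). The Taylor series of χ(U) and Φ(U) come from Fourier series: the coefficients decay
rapidly, and the j-th Taylor coefficient of U^k grows only like |k|^j
(`exists_isTaylorSeries_funCalc`). A finite partition of the support of Φ gives the general case.

Real exponents follow from the even integers by the interpolation inequality ‖bTb‖² ≤ ‖T‖ ‖b²Tb²‖
(`norm_mul_mul_sq_le`), iterated. Rounding a large weight down to an even integer costs the gap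
between s' and s. Negative m is reduced to positive m by taking adjoints. -/

theorem inner_apply_symm (hA : IsSelfAdjoint A) (x y : A.domain) :
    ⟪A x, (y : H)⟫_ℂ = ⟪(x : H), A y⟫_ℂ := by
  have h := LinearPMap.adjoint_isFormalAdjoint (T := A) hA.dense_domain
  rw [LinearPMap.isSelfAdjoint_def.mp hA] at h
  exact h x y

theorem exists_mem_domain_of_inner_eq (hA : IsSelfAdjoint A) {y w : H}
    (h : ∀ x : A.domain, ⟪w, (x : H)⟫_ℂ = ⟪y, A x⟫_ℂ) :
    ∃ hy : y ∈ A.domain, A ⟨y, hy⟩ = w := by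
  have hy : y ∈ A.adjoint.domain := LinearPMap.mem_adjoint_domain_of_exists y ⟨w, h⟩
  have hw := LinearPMap.adjoint_apply_eq hA.dense_domain ⟨y, hy⟩ h
  have aux : ∀ T : H →ₗ.[ℂ] H, T = A → ∀ h' : y ∈ T.domain, T ⟨y, h'⟩ = w →
      ∃ hy : y ∈ A.domain, A ⟨y, hy⟩ = w := by
    rintro T rfl h' hw; exact ⟨h', hw⟩
  exact aux _ (LinearPMap.isSelfAdjoint_def.mp hA) hy hw

variable {B B' C C' : H →L[ℂ] H}

/-- The form identity says that φ ↦ ⟪Aφ, Bψ⟫ is bounded, so Bψ lies in the domain of A* = A. This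
turns the weak commutator into an operator identity on the domain, as the Leibniz rule requires. -/
theorem IsCommutator.exists_apply_eq (hA : IsSelfAdjoint A) (h : IsCommutator A B C)
    (ψ : A.domain) : ∃ hψ : B ψ ∈ A.domain, A ⟨B ψ, hψ⟩ = B (A ψ) + C ψ := by
  refine exists_mem_domain_of_inner_eq hA fun φ => ?_
  have h1 := congrArg (starRingEnd ℂ) (h φ ψ)
  rw [map_sub, inner_conj_symm, inner_conj_symm, inner_conj_symm] at h1
  rw [inner_add_left, ← h1]
  ring

theorem IsCommutator.unique (hA : IsSelfAdjoint A) (h : IsCommutator A B C)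
    (h' : IsCommutator A B C') : C = C' := by
  refine ContinuousLinearMap.coeFn_injective
    (C.continuous.ext_on hA.dense_domain C'.continuous fun ψ hψ => ?_)
  refine Dense.eq_of_inner_right ℂ hA.dense_domain fun φ hφ => ?_
  exact (h ⟨φ, hφ⟩ ⟨ψ, hψ⟩).symm.trans (h' ⟨φ, hφ⟩ ⟨ψ, hψ⟩)

theorem IsCommutator.mul (hA : IsSelfAdjoint A) (h : IsCommutator A B C)
    (h' : IsCommutator A B' C') : IsCommutator A (B * B') (C * B' + B * C') := by
  intro φ ψ
  obtain ⟨hψ, hψ'⟩ := h'.exists_apply_eq hA ψ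
  have h1 := h φ ⟨B' ψ, hψ⟩
  rw [hψ', map_add, inner_add_right] at h1
  simp only [mul_apply_eq_comp, add_apply, inner_add_right]
  rw [← h1]
  ring

theorem IsCommutator.add (h : IsCommutator A B C) (h' : IsCommutator A B' C') :
    IsCommutator A (B + B') (C + C') := by
  intro φ ψ
  have h1 := h φ ψ
  have h2 := h' φ ψ
  simp only [add_apply, inner_add_right]
  rw [← h1, ← h2]
  ring

theorem IsCommutator.smul (h : IsCommutator A B C) (c : ℂ) :
    IsCommutator A (c • B) (c • C) := by
  intro φ ψ
  simp only [smul_apply, inner_smul_right]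
  rw [← h φ ψ]
  ring

theorem isCommutator_zero : IsCommutator A (0 : H →L[ℂ] H) 0 := by
  intro φ ψ
  simp

theorem isCommutator_one (hA : IsSelfAdjoint A) : IsCommutator A (1 : H →L[ℂ] H) 0 := by
  intro φ ψ
  simp [inner_apply_symm hA]

theorem IsCommutator.sum {ι : Type*} (s : Finset ι) {f g : ι → H →L[ℂ] H}
    (h : ∀ i ∈ s, IsCommutator A (f i) (g i)) :
    IsCommutator A (∑ i ∈ s, f i) (∑ i ∈ s, g i) := by
  classical
  induction s using Finset.induction_on with
  | empty => simpa using isCommutator_zero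
  | insert a s ha ih =>
    rw [Finset.sum_insert ha, Finset.sum_insert ha]
    exact (h a (Finset.mem_insert_self _ _)).add
      (ih fun i hi => h i (Finset.mem_insert_of_mem hi))

/-- The relation only involves matrix elements of the two operators, so it survives convergent sums.
It is used to pass from powers of U to Fourier series in U. -/
theorem IsCommutator.hasSum {ι : Type*} {f g : ι → H →L[ℂ] H}
    (h : ∀ i, IsCommutator A (f i) (g i)) (hf : HasSum f B) (hg : HasSum g C) :
    IsCommutator A B C := by
  intro φ ψ
  have key : ∀ {f : ι → H →L[ℂ] H} {B : H →L[ℂ] H}, HasSum f B → ∀ x y : H,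
      HasSum (fun i => ⟪x, f i y⟫_ℂ) ⟪x, B y⟫_ℂ := fun {f B} hf x y =>
    ((innerSL ℂ x).hasSum (((ContinuousLinearMap.apply ℂ H) y).hasSum hf) :)
  refine HasSum.unique ?_ (key hg φ ψ)
  have h1 := (key hf (A φ) ψ).sub (key hf φ (A ψ))
  simpa only [h _ φ ψ] using h1

theorem IsCommutator.star (h : IsCommutator A B C) :
    IsCommutator A (star B) (-star C) := by
  intro φ ψ
  have h1 := congrArg (starRingEnd ℂ) (h ψ φ)
  rw [map_sub, inner_conj_symm, inner_conj_symm, inner_conj_symm] at h1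
  simp only [ContinuousLinearMap.star_eq_adjoint, neg_apply, inner_neg_right,
    ContinuousLinearMap.adjoint_inner_right]
  rw [← h1]
  ring

theorem isCommutator_ad (h : IsC1 A B) : IsCommutator A B (ad A B) := by
  unfold ad
  rw [dif_pos h]
  exact Classical.choose_spec h

end Commutator

/-! ### Taylor series of `ε ↦ e^{-εA} B e^{εA}` -/

section Taylor

variable {A : H →ₗ.[ℂ] H} {X Y : PowerSeries (H →L[ℂ] H)}

/-- The power series `X` is the formal Taylor series of `ε ↦ e^{-εA} B e^{εA}`, where `B` is its
constant coefficient: it is a formal solution of `X' = -ad_A X`. -/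
def IsTaylorSeries (A : H →ₗ.[ℂ] H) (X : PowerSeries (H →L[ℂ] H)) : Prop :=
  ∀ n : ℕ, IsCommutator A (PowerSeries.coeff n X)
    (-((n + 1 : ℂ) • PowerSeries.coeff (n + 1) X))

theorem IsTaylorSeries.one (hA : IsSelfAdjoint A) : IsTaylorSeries A 1 := by
  intro n
  rw [PowerSeries.coeff_one, PowerSeries.coeff_one, if_neg n.succ_ne_zero, smul_zero, neg_zero]
  split_ifs
  · exact isCommutator_one hA
  · exact isCommutator_zero

/-- Formally e^{-εA} B B' e^{εA} is the product of the two deformed operators. Coefficientwise, the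
factor n + 1 = i + j splits between the two factors, and this is the Leibniz rule. -/
theorem IsTaylorSeries.mul (hA : IsSelfAdjoint A) (hX : IsTaylorSeries A X)
    (hY : IsTaylorSeries A Y) : IsTaylorSeries A (X * Y) := by
  intro n
  rw [PowerSeries.coeff_mul, PowerSeries.coeff_mul]
  have h1 : (n + 1 : ℂ) • ∑ p ∈ Finset.HasAntidiagonal.antidiagonal (n + 1),
        PowerSeries.coeff p.1 X * PowerSeries.coeff p.2 Y =
      ∑ p ∈ Finset.HasAntidiagonal.antidiagonal (n + 1),
        (p.1 : ℂ) • (PowerSeries.coeff p.1 X * PowerSeries.coeff p.2 Y) +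
      ∑ p ∈ Finset.HasAntidiagonal.antidiagonal (n + 1),
        (p.2 : ℂ) • (PowerSeries.coeff p.1 X * PowerSeries.coeff p.2 Y) := by
    rw [Finset.smul_sum, ← Finset.sum_add_distrib]
    refine Finset.sum_congr rfl fun p hp => ?_
    rw [← add_smul, ← Nat.cast_add, Finset.HasAntidiagonal.mem_antidiagonal.mp hp]
    push_cast
    rfl
  have h2 : -((n + 1 : ℂ) • ∑ p ∈ Finset.HasAntidiagonal.antidiagonal (n + 1),
        PowerSeries.coeff p.1 X * PowerSeries.coeff p.2 Y) =
      ∑ p ∈ Finset.HasAntidiagonal.antidiagonal n,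
        (-((p.1 + 1 : ℂ) • PowerSeries.coeff (p.1 + 1) X) * PowerSeries.coeff p.2 Y +
          PowerSeries.coeff p.1 X * -((p.2 + 1 : ℂ) • PowerSeries.coeff (p.2 + 1) Y)) := by
    rw [h1, Finset.Nat.sum_antidiagonal_succ, Finset.Nat.sum_antidiagonal_succ', neg_add,
      Finset.sum_add_distrib]
    simp [Finset.sum_neg_distrib]
  rw [h2]
  exact IsCommutator.sum _ fun p _ => (hX p.1).mul hA (hY p.2)

theorem IsTaylorSeries.pow (hA : IsSelfAdjoint A) (hX : IsTaylorSeries A X) (n : ℕ) :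
    IsTaylorSeries A (X ^ n) := by
  induction n with
  | zero => simpa using IsTaylorSeries.one hA
  | succ n ih => rw [pow_succ]; exact ih.mul hA hX

/-- The Taylor series of the adjoint operator. -/
def starSeries (X : PowerSeries (H →L[ℂ] H)) : PowerSeries (H →L[ℂ] H) :=
  PowerSeries.mk fun n => (-1 : ℂ) ^ n • star (PowerSeries.coeff n X)

/-- The adjoint of e^{-εA} B e^{εA} is e^{εA} B* e^{-εA}, the flow of B* at -ε; hence the
alternating sign in `starSeries`. -/
theorem IsTaylorSeries.star (hX : IsTaylorSeries A X) : IsTaylorSeries A (starSeries X) := by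
  intro n
  rw [starSeries, PowerSeries.coeff_mk, PowerSeries.coeff_mk]
  convert ((hX n).star).smul ((-1 : ℂ) ^ n) using 1
  simp only [star_neg, star_smul, neg_neg, smul_smul, pow_succ]
  rw [← neg_smul]
  congr 1
  simp
  ring

theorem IsCinfty.exists_isTaylorSeries {B : H →L[ℂ] H} (hB : IsCinfty A B) :
    ∃ X, IsTaylorSeries A X ∧ PowerSeries.coeff 0 X = B ∧ PowerSeries.coeff 1 X = -ad A B := by
  refine ⟨PowerSeries.mk fun n => ((-1 : ℂ) ^ n / (n.factorial : ℂ)) • (ad A)^[n] B,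
    fun n => ?_, by simp, by simp⟩
  rw [PowerSeries.coeff_mk, PowerSeries.coeff_mk]
  convert (isCommutator_ad (hB (n + 1) n n.lt_succ_self)).smul
    ((-1 : ℂ) ^ n / (n.factorial : ℂ)) using 1
  rw [Function.iterate_succ_apply', smul_smul, ← neg_smul]
  congr 1
  have h1 : (n.factorial : ℂ) ≠ 0 := by exact_mod_cast n.factorial_ne_zero
  have h2 : (n + 1 : ℂ) ≠ 0 := by exact_mod_cast n.succ_ne_zero
  rw [Nat.factorial_succ]
  push_cast
  field_simp
  ring

/-- If the constant coefficient is a contraction, the `j`-th coefficient of the powers grows at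
most like `n ^ j`. -/
theorem exists_norm_coeff_pow_le (X : PowerSeries (H →L[ℂ] H))
    (hX : ‖PowerSeries.coeff 0 X‖ ≤ 1) (j : ℕ) :
    ∃ C : ℝ, 0 ≤ C ∧ ∀ n : ℕ, ‖PowerSeries.coeff j (X ^ n)‖ ≤ C * (n + 1 : ℝ) ^ j := by
  induction j using Nat.strong_induction_on with
  | _ j ih =>
    choose! C hC0 hC using ih
    set K : ℝ := ∑ i ∈ Finset.range j, C i * ‖PowerSeries.coeff (j - i) X‖ with hK
    have hK0 : 0 ≤ K := Finset.sum_nonneg fun i hi =>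
      mul_nonneg (hC0 i (Finset.mem_range.mp hi)) (norm_nonneg _)
    refine ⟨K + 1, by linarith, fun n => ?_⟩
    -- In X^n · X the term carrying the constant coefficient of X does not increase the norm. All
    -- other terms involve coefficients of X^n of order below j, which grow at most like n^{j-1};
    -- summing over n costs one power.
    have hstep : ∀ n : ℕ, ‖PowerSeries.coeff j (X ^ (n + 1))‖ ≤
        ‖PowerSeries.coeff j (X ^ n)‖ + K * (n + 1 : ℝ) ^ (j - 1) := by
      intro n
      rw [pow_succ, PowerSeries.coeff_mul, Finset.Nat.sum_antidiagonal_eq_sum_range_succ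
        (fun a b => PowerSeries.coeff a (X ^ n) * PowerSeries.coeff b X),
        Finset.sum_range_succ, add_comm, Nat.sub_self]
      refine (norm_add_le _ _).trans (add_le_add ?_ ?_)
      · exact (norm_mul_le _ _).trans (mul_le_of_le_one_right (norm_nonneg _) hX)
      · rw [hK, Finset.sum_mul]
        refine norm_sum_le_of_le _ fun i hi => (norm_mul_le _ _).trans ?_
        have hi' := Finset.mem_range.mp hi
        have h1 : (n + 1 : ℝ) ^ i ≤ (n + 1 : ℝ) ^ (j - 1) :=
          pow_le_pow_right₀ (by simp) (by omega)
        calc _ ≤ C i * (n + 1 : ℝ) ^ i * ‖PowerSeries.coeff (j - i) X‖ := by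
              gcongr; exact hC i hi' n
          _ ≤ C i * (n + 1 : ℝ) ^ (j - 1) * ‖PowerSeries.coeff (j - i) X‖ := by
              gcongr; exact hC0 i hi'
          _ = _ := by ring
    have hsum : ∀ n : ℕ, ‖PowerSeries.coeff j (X ^ n)‖ ≤
        1 + n * (K * (n + 1 : ℝ) ^ (j - 1)) := by
      intro n
      induction n with
      | zero =>
        rw [pow_zero, PowerSeries.coeff_one]
        split_ifs
        · exact ContinuousLinearMap.norm_id_le.trans (by simp)
        · simp
      | succ n ihn =>
        have h1 : (n + 1 : ℝ) ^ (j - 1) ≤ (((n + 1 : ℕ) : ℝ) + 1) ^ (j - 1) := by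
          push_cast; gcongr; linarith
        have h2 := hstep n
        have h3 : K * (n + 1 : ℝ) ^ (j - 1) ≤ K * (((n + 1 : ℕ) : ℝ) + 1) ^ (j - 1) := by gcongr
        have h4 : n * (K * (n + 1 : ℝ) ^ (j - 1)) ≤
            n * (K * (((n + 1 : ℕ) : ℝ) + 1) ^ (j - 1)) := by gcongr
        have h5 : (((n + 1 : ℕ) : ℝ)) * (K * (((n + 1 : ℕ) : ℝ) + 1) ^ (j - 1)) =
          n * (K * (((n + 1 : ℕ) : ℝ) + 1) ^ (j - 1)) + K * (((n + 1 : ℕ) : ℝ) + 1) ^ (j - 1) := by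
          push_cast; ring
        rw [h5]
        linarith
    have h1 := hsum n
    have h2 : (1 : ℝ) ≤ (n + 1 : ℝ) ^ j := one_le_pow₀ (by simp)
    -- For j = 0 the exponent j - 1 is truncated to 0, but then K is an empty sum.
    rcases Nat.eq_zero_or_pos j with rfl | hj
    · have : K = 0 := by simp [hK]
      simp only [this] at h1 ⊢
      simpa using h1
    · have h3 : (n : ℝ) * (n + 1 : ℝ) ^ (j - 1) ≤ (n + 1 : ℝ) ^ j := by
        obtain ⟨i, rfl⟩ : ∃ i, j = i + 1 := ⟨j - 1, by omega⟩
        rw [Nat.add_sub_cancel, pow_succ, mul_comm]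
        gcongr
        linarith
      nlinarith [mul_le_mul_of_nonneg_left h3 hK0]

end Taylor

/-! ### The bounded operators `A ^ i (A² + 1)⁻ⁿ` -/

section Weights

variable {A : H →ₗ.[ℂ] H}

/-- `A (A² + 1)⁻¹` is a bounded operator. -/
theorem exists_apply_invSqAddOne (hA : IsSelfAdjoint A) :
    ∃ C : H →L[ℂ] H, ∀ y, (∃ h : invSqAddOne A y ∈ A.domain, A ⟨_, h⟩ = C y) ∧
      ∃ h : C y ∈ A.domain, A ⟨_, h⟩ = y - invSqAddOne A y := by
  have hR := (invSqAddOne_spec hA).1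
  choose h₁ h₂ h₃ using hR
  let L : H →ₗ[ℂ] H := A.toFun.comp
    ((invSqAddOne A : H →ₗ[ℂ] H).codRestrict A.domain h₁)
  have hL : ∀ y, L y = A ⟨invSqAddOne A y, h₁ y⟩ := fun y => rfl
  have hb : ∀ y, ‖L y‖ ≤ (‖invSqAddOne A‖ + 1) * ‖y‖ := by
    intro y
    -- With R = (A² + 1)⁻¹: ‖ARy‖² = ⟪Ry, A²Ry⟫ and A²R = 1 - R.
    have h4 : ⟪L y, L y⟫_ℂ = ⟪invSqAddOne A y, y - invSqAddOne A y⟫_ℂ := by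
      rw [hL]
      have := inner_apply_symm hA ⟨invSqAddOne A y, h₁ y⟩ ⟨_, h₂ y⟩
      rw [this, eq_sub_of_add_eq (h₃ y)]
    have h5 := congrArg Complex.re h4
    have h6 : (⟪L y, L y⟫_ℂ).re = ‖L y‖ ^ 2 := inner_self_eq_norm_sq (𝕜 := ℂ) _
    have h7 : (⟪invSqAddOne A y, invSqAddOne A y⟫_ℂ).re = ‖invSqAddOne A y‖ ^ 2 :=
      inner_self_eq_norm_sq (𝕜 := ℂ) _
    have h8 : (⟪invSqAddOne A y, y⟫_ℂ).re ≤ ‖invSqAddOne A y‖ * ‖y‖ :=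
      (Complex.re_le_norm _).trans (norm_inner_le_norm _ _)
    rw [h6, inner_sub_right, Complex.sub_re, h7] at h5
    have h9 : ‖invSqAddOne A y‖ ≤ ‖invSqAddOne A‖ * ‖y‖ := (invSqAddOne A).le_opNorm y
    have h10 : ‖L y‖ ^ 2 ≤ ((‖invSqAddOne A‖ + 1) * ‖y‖) ^ 2 := by
      have := mul_le_mul_of_nonneg_right h9 (norm_nonneg y)
      nlinarith [sq_nonneg ‖invSqAddOne A y‖, norm_nonneg (invSqAddOne A), sq_nonneg ‖y‖,
        mul_nonneg (norm_nonneg (invSqAddOne A)) (sq_nonneg ‖y‖),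
        mul_nonneg (sq_nonneg ‖invSqAddOne A‖) (sq_nonneg ‖y‖)]
    exact (abs_le_of_sq_le_sq' h10 (by positivity)).2
  refine ⟨L.mkContinuous _ hb, fun y => ⟨⟨h₁ y, rfl⟩, h₂ y, eq_sub_of_add_eq (h₃ y)⟩⟩

/-- The operators `A ^ i (A² + 1)⁻ⁿ`, `i ≤ 2n`, are bounded. -/
theorem exists_weights (hA : IsSelfAdjoint A) (n : ℕ) :
    ∃ b : ℕ → H →L[ℂ] H, b 0 = invSqAddOne A ^ n ∧
      ∀ i < 2 * n, ∀ y, ∃ h : b i y ∈ A.domain, A ⟨_, h⟩ = b (i + 1) y := by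
  obtain ⟨C, hC⟩ := exists_apply_invSqAddOne hA
  set R := invSqAddOne A with hR
  -- From A²R = 1 - R: each pair of factors A trades one R for 1 - R, and a leftover A is absorbed
  -- in C = AR.
  let b : ℕ → H →L[ℂ] H := fun i => if Even i then R ^ (n - i / 2) * (1 - R) ^ (i / 2)
    else C * (R ^ (n - i / 2 - 1) * (1 - R) ^ (i / 2))
  have heven : ∀ q, b (2 * q) = R ^ (n - q) * (1 - R) ^ q := by
    intro q
    simp [b]
  have hodd : ∀ q, b (2 * q + 1) = C * (R ^ (n - q - 1) * (1 - R) ^ q) := by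
    intro q
    have h2 : (2 * q + 1) / 2 = q := by omega
    simp [b, h2]
  have hcomm : Commute R (1 - R) := (Commute.one_right R).sub_right (Commute.refl R)
  refine ⟨b, by simp [b], fun i hi y => ?_⟩
  rcases Nat.even_or_odd' i with ⟨q, rfl | rfl⟩
  · have h3 : n - q = n - q - 1 + 1 := by omega
    have h4 : R ^ (n - q) * (1 - R) ^ q = R * (R ^ (n - q - 1) * (1 - R) ^ q) := by
      rw [← mul_assoc, ← pow_succ', ← h3]
    rw [hodd, heven, h4]
    exact (hC _).1
  · have h5 : R ^ (n - (q + 1)) * (1 - R) ^ (q + 1) =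
        (1 - R) * (R ^ (n - q - 1) * (1 - R) ^ q) := by
      rw [pow_succ', ← mul_assoc, ← mul_assoc, (hcomm.pow_left _).eq, Nat.sub_sub]
    rw [hodd, show 2 * q + 1 + 1 = 2 * (q + 1) by ring, heven, h5]
    exact (hC _).2

end Weights

/-! ### Decay from a contractive complex deformation -/

section Decay

variable {A : H →ₗ.[ℂ] H}

/-- The truncation of the power series `X` at order `N`, evaluated at `ε`. -/
def truncEval (N : ℕ) (X : PowerSeries (H →L[ℂ] H)) (ε : ℝ) : H →L[ℂ] H :=
  ∑ j ∈ Finset.range (N + 1), (ε : ℂ) ^ j • PowerSeries.coeff j X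

/-- At `ε`, the curve `Q` solves `Q' = -ad_A Q` up to the error `ρ`. -/
def IsApproxFlow (A : H →ₗ.[ℂ] H) (Q : ℝ → H →L[ℂ] H) (Q' ρ : H →L[ℂ] H) (ε : ℝ) : Prop :=
  HasDerivAt Q Q' ε ∧ IsCommutator A (Q ε) (-(Q' + ρ))

theorem IsApproxFlow.mul (hA : IsSelfAdjoint A) {Q₁ Q₂ : ℝ → H →L[ℂ] H}
    {Q₁' Q₂' ρ₁ ρ₂ : H →L[ℂ] H} {ε : ℝ} (h₁ : IsApproxFlow A Q₁ Q₁' ρ₁ ε)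
    (h₂ : IsApproxFlow A Q₂ Q₂' ρ₂ ε) :
    IsApproxFlow A (fun ε => Q₁ ε * Q₂ ε) (Q₁' * Q₂ ε + Q₁ ε * Q₂')
      (ρ₁ * Q₂ ε + Q₁ ε * ρ₂) ε := by
  refine ⟨h₁.1.mul h₂.1, ?_⟩
  convert h₁.2.mul hA h₂.2 using 1
  noncomm_ring

/-- By the Leibniz rule the defect of a power is a sum of m terms with one factor ρ and m - 1
factors Q ε. The growth is thus only linear in m, and contractivity of the other factors is kept. -/
theorem IsApproxFlow.pow (hA : IsSelfAdjoint A) {Q : ℝ → H →L[ℂ] H}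
    {Q' ρ : H →L[ℂ] H} {ε : ℝ} (h : IsApproxFlow A Q Q' ρ ε) {r : ℝ} (hr : ‖Q ε‖ ≤ r) (m : ℕ) :
    ∃ Q'' ρ', IsApproxFlow A (fun ε => Q ε ^ m) Q'' ρ' ε ∧
      ‖ρ'‖ ≤ m * r ^ (m - 1) * ‖ρ‖ := by
  have hr0 : 0 ≤ r := (norm_nonneg _).trans hr
  induction m with
  | zero =>
    refine ⟨0, 0, ⟨?_, ?_⟩, by simp⟩
    · simpa using hasDerivAt_const ε (1 : H →L[ℂ] H)
    · simpa using isCommutator_one hA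
  | succ m ih =>
    obtain ⟨Q'', ρ', h1, h2⟩ := ih
    refine ⟨_, _, by simpa only [pow_succ] using h1.mul hA h, ?_⟩
    have h3 : ‖Q ε ^ m‖ ≤ r ^ m := by
      rcases Nat.eq_zero_or_pos m with rfl | hm
      · exact ContinuousLinearMap.norm_id_le.trans (by simp)
      · exact (norm_pow_le' _ hm).trans (by gcongr)
    have h4 : (m : ℝ) * r ^ (m - 1) * r = m * r ^ m := by
      rcases m with _ | m
      · simp
      · rw [Nat.add_sub_cancel, pow_succ]; ring
    calc ‖ρ' * Q ε + Q ε ^ m * ρ‖ ≤ ‖ρ'‖ * ‖Q ε‖ + ‖Q ε ^ m‖ * ‖ρ‖ :=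
          (norm_add_le _ _).trans (add_le_add (norm_mul_le _ _) (norm_mul_le _ _))
      _ ≤ m * r ^ (m - 1) * ‖ρ‖ * r + r ^ m * ‖ρ‖ := by gcongr
      _ = (m * r ^ (m - 1) * r) * ‖ρ‖ + r ^ m * ‖ρ‖ := by ring
      _ = ((m + 1 : ℕ) : ℝ) * r ^ (m + 1 - 1) * ‖ρ‖ := by
        rw [h4, Nat.add_sub_cancel]; push_cast; ring

theorem hasDerivAt_ofReal_pow (j : ℕ) (ε : ℝ) :
    HasDerivAt (fun ε : ℝ => (ε : ℂ) ^ j) (j * (ε : ℂ) ^ (j - 1)) ε := by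
  simpa using (hasDerivAt_pow j (ε : ℂ)).comp_ofReal

/-- The commutator raises the order by one, so the only defect is the derivative of the first
omitted Taylor term. -/
theorem isApproxFlow_truncEval {X : PowerSeries (H →L[ℂ] H)} (hX : IsTaylorSeries A X)
    (N : ℕ) (ε : ℝ) :
    ∃ Q', IsApproxFlow A (truncEval N X) Q'
      (((N + 1 : ℂ) * (ε : ℂ) ^ N) • PowerSeries.coeff (N + 1) X) ε := by
  refine ⟨∑ j ∈ Finset.range (N + 1), (j * (ε : ℂ) ^ (j - 1)) • PowerSeries.coeff j X, ?_, ?_⟩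
  · exact HasDerivAt.fun_sum fun j _ => (hasDerivAt_ofReal_pow j ε).smul_const _
  · have h1 := IsCommutator.sum (Finset.range (N + 1))
      fun j _ => (hX j).smul ((ε : ℂ) ^ j)
    refine (congrArg (IsCommutator A (truncEval N X ε)) ?_).mpr h1
    have h2 : ∑ j ∈ Finset.range (N + 1), ((j : ℂ) * (ε : ℂ) ^ (j - 1)) • PowerSeries.coeff j X +
        ((N + 1 : ℂ) * (ε : ℂ) ^ N) • PowerSeries.coeff (N + 1) X =
        ∑ j ∈ Finset.range (N + 2), ((j : ℂ) * (ε : ℂ) ^ (j - 1)) • PowerSeries.coeff j X := by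
      rw [Finset.sum_range_succ _ (N + 1)]
      simp
    rw [h2, Finset.sum_range_succ']
    simp [smul_smul, mul_comm, Finset.sum_neg_distrib]

/-- The truncated exponential series with coefficients `b`. -/
def expTrunc (b : ℕ → H →L[ℂ] H) (p : ℕ) (ε : ℝ) : H →L[ℂ] H :=
  ∑ i ∈ Finset.range p, ((ε : ℂ) ^ i / (i.factorial : ℂ)) • b i

theorem hasDerivAt_expTrunc (b : ℕ → H →L[ℂ] H) (p : ℕ) (ε : ℝ) :
    HasDerivAt (expTrunc b (p + 1)) (expTrunc (fun i => b (i + 1)) p ε) ε := by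
  have h := HasDerivAt.fun_sum (u := Finset.range (p + 1))
    fun i _ => ((hasDerivAt_ofReal_pow i ε).div_const (i.factorial : ℂ)).smul_const (b i)
  refine h.congr_deriv ?_
  rw [Finset.sum_range_succ', expTrunc]
  simp only [Nat.cast_zero, zero_mul, zero_div, zero_smul, add_zero, Nat.add_sub_cancel]
  refine Finset.sum_congr rfl fun i _ => ?_
  congr 1
  have h1 : (i.factorial : ℂ) ≠ 0 := by exact_mod_cast i.factorial_ne_zero
  have h2 : (i + 1 : ℂ) ≠ 0 := by exact_mod_cast i.succ_ne_zero
  rw [Nat.factorial_succ]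
  push_cast
  field_simp

theorem apply_expTrunc {b : ℕ → H →L[ℂ] H} {p : ℕ}
    (hb : ∀ i < p, ∀ y, ∃ h : b i y ∈ A.domain, A ⟨_, h⟩ = b (i + 1) y) (ε : ℝ) (y : H) :
    ∃ h : expTrunc b p ε y ∈ A.domain,
      A ⟨_, h⟩ = expTrunc (fun i => b (i + 1)) p ε y := by
  induction p with
  | zero =>
    refine ⟨by simp [expTrunc], ?_⟩
    have h0 : (⟨expTrunc b 0 ε y, by simp [expTrunc]⟩ : A.domain) = 0 :=
      Subtype.ext (by simp [expTrunc])
    rw [h0, A.map_zero]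
    simp [expTrunc]
  | succ p ih =>
    obtain ⟨h1, h2⟩ := ih fun i hi => hb i (by omega)
    obtain ⟨h3, h4⟩ := hb p p.lt_succ_self y
    have h5 : ∀ b : ℕ → H →L[ℂ] H, expTrunc b (p + 1) ε y =
        expTrunc b p ε y + ((ε : ℂ) ^ p / (p.factorial : ℂ)) • b p y := by
      intro b
      simp [expTrunc, Finset.sum_range_succ]
    have h6 : expTrunc b (p + 1) ε y ∈ A.domain := by
      rw [h5]
      exact A.domain.add_mem h1 (A.domain.smul_mem _ h3)
    refine ⟨h6, ?_⟩
    have h7 : (⟨_, h6⟩ : A.domain) = ⟨_, h1⟩ + ((ε : ℂ) ^ p / (p.factorial : ℂ)) • ⟨_, h3⟩ :=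
      Subtype.ext (h5 b)
    rw [h7, A.map_add, A.map_smul, h2, h4, h5]

theorem exists_norm_le_of_continuous {f : ℝ → H →L[ℂ] H} (hf : Continuous f) (a b : ℝ) :
    ∃ C : ℝ, 0 ≤ C ∧ ∀ ε ∈ Set.Icc a b, ‖f ε‖ ≤ C := by
  obtain ⟨C, hC⟩ := isCompact_Icc.exists_bound_of_continuousOn hf.continuousOn (s := Set.Icc a b)
  exact ⟨max C 0, le_max_right _ _, fun ε hε => (hC ε hε).trans (le_max_left _ _)⟩

theorem continuous_truncEval (N : ℕ) (X : PowerSeries (H →L[ℂ] H)) :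
    Continuous (truncEval N X) :=
  continuous_finsetSum _ fun _ _ => (Complex.continuous_ofReal.pow _).smul continuous_const

theorem continuous_expTrunc (b : ℕ → H →L[ℂ] H) (p : ℕ) : Continuous (expTrunc b p) :=
  continuous_finsetSum _ fun _ _ =>
    ((Complex.continuous_ofReal.pow _).div_const _).smul continuous_const

/-- Half of the exponential turns ε^q into m^{-q}; the other half is kept so that integration over ε
yields one more factor 1/m. -/
theorem pow_mul_exp_le {c m ε : ℝ} (hc : 0 < c) (hm : 0 < m) (hε : 0 ≤ ε) (q : ℕ) :
    ε ^ q * Real.exp (-(c * ε * m)) ≤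
      q.factorial * (2 / c) ^ q * (1 / m ^ q) * Real.exp (-(c / 2 * m * ε)) := by
  have hx : 0 ≤ c / 2 * m * ε := by positivity
  have h1 := Real.pow_div_factorial_le_exp _ hx q
  have hq : (0 : ℝ) < q.factorial := by exact_mod_cast q.factorial_pos
  rw [div_le_iff₀ hq] at h1
  have h2 : Real.exp (-(c * ε * m)) =
      Real.exp (-(c / 2 * m * ε)) * Real.exp (-(c / 2 * m * ε)) := by
    rw [← Real.exp_add]; congr 1; ring
  have h3 : ε ^ q = (2 / c) ^ q * (1 / m ^ q) * (c / 2 * m * ε) ^ q := by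
    rw [mul_pow, mul_pow, div_pow, div_pow]
    field_simp
  have h4 : Real.exp (c / 2 * m * ε) * Real.exp (-(c / 2 * m * ε)) = 1 := by
    rw [← Real.exp_add]; simp
  calc ε ^ q * Real.exp (-(c * ε * m))
      = (2 / c) ^ q * (1 / m ^ q) * Real.exp (-(c / 2 * m * ε)) *
          ((c / 2 * m * ε) ^ q * Real.exp (-(c / 2 * m * ε))) := by rw [h2, h3]; ring
    _ ≤ (2 / c) ^ q * (1 / m ^ q) * Real.exp (-(c / 2 * m * ε)) *
          (Real.exp (c / 2 * m * ε) * q.factorial * Real.exp (-(c / 2 * m * ε))) := by gcongr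
    _ = (2 / c) ^ q * (1 / m ^ q) * Real.exp (-(c / 2 * m * ε)) *
          (q.factorial * (Real.exp (c / 2 * m * ε) * Real.exp (-(c / 2 * m * ε)))) := by ring
    _ = _ := by rw [h4]; ring

theorem hasDerivAt_apply {Q : ℝ → H →L[ℂ] H} {Q' : H →L[ℂ] H} {ε : ℝ} (h : HasDerivAt Q Q' ε)
    (y : H) : HasDerivAt (fun ε => Q ε y) (Q' y) ε :=
  (((ContinuousLinearMap.apply ℂ H y).restrictScalars ℝ).hasFDerivAt.comp_hasDerivAt ε h :)

/-- The derivative of the pairing `⟪e^{εA} x, Q e^{-εA} y⟫`, with truncated exponentials, along an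
approximate flow. -/
theorem IsApproxFlow.hasDerivAt_pairing {b : ℕ → H →L[ℂ] H} {p : ℕ}
    (hb : ∀ i < p + 1, ∀ y, ∃ h : b i y ∈ A.domain, A ⟨_, h⟩ = b (i + 1) y)
    {Q : ℝ → H →L[ℂ] H} {Q' ρ : H →L[ℂ] H} {ε : ℝ} (hQ : IsApproxFlow A Q Q' ρ ε) (x y : H) :
    HasDerivAt (fun ε => ⟪expTrunc b (p + 1) ε x, Q ε (expTrunc b (p + 1) (-ε) y)⟫_ℂ)
      (-⟪((ε : ℂ) ^ p / (p.factorial : ℂ)) • b (p + 1) x, Q ε (expTrunc b (p + 1) (-ε) y)⟫_ℂ +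
        ⟪expTrunc b (p + 1) ε x, Q ε ((((-ε : ℝ) : ℂ) ^ p / (p.factorial : ℂ)) • b (p + 1) y)⟫_ℂ -
        ⟪expTrunc b (p + 1) ε x, ρ (expTrunc b (p + 1) (-ε) y)⟫_ℂ) ε := by
  have hP := hasDerivAt_expTrunc b p ε
  have hN : HasDerivAt (fun ε => expTrunc b (p + 1) (-ε))
      (-expTrunc (fun i => b (i + 1)) p (-ε)) ε := by
    have h := (hasDerivAt_expTrunc b p (-ε)).scomp ε (hasDerivAt_neg ε)
    rw [neg_one_smul] at h
    exact h
  have h1 := (hasDerivAt_apply hP x).inner ℂ (hasDerivAt_apply (hQ.1.mul hN) y)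
  refine h1.congr_deriv ?_
  obtain ⟨hx, hx'⟩ := apply_expTrunc hb ε x
  obtain ⟨hy, hy'⟩ := apply_expTrunc hb (-ε) y
  -- The commutator relation cancels everything except the two top terms of the truncated
  -- exponentials and the defect ρ.
  have h2 := hQ.2 ⟨_, hx⟩ ⟨_, hy⟩
  have h3 : ∀ (ε : ℝ) (y : H), expTrunc (fun i => b (i + 1)) (p + 1) ε y =
      expTrunc (fun i => b (i + 1)) p ε y + ((ε : ℂ) ^ p / (p.factorial : ℂ)) • b (p + 1) y := by
    intro ε y
    simp [expTrunc, Finset.sum_range_succ]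
  rw [hx', hy', h3, h3] at h2
  simp only [inner_add_left, inner_add_right, map_add, neg_apply, add_apply,
    inner_neg_right, mul_apply_eq_comp, map_neg, Pi.mul_apply] at h2 ⊢
  linear_combination h2

/-- The pairing of the truncated exponentials is followed from ε₀, where V(ε₀)^m is exponentially
small, down to 0. The Taylor polynomials have order p + 1 so that their defect m ε^{p+1} e^{-cεm}
balances the exponential truncation error ε^p e^{-cεm}: both integrate to O(m^{-(p+1)}). -/
theorem exists_norm_pairing_le (hA : IsSelfAdjoint A) {b : ℕ → H →L[ℂ] H} {p : ℕ}
    (hb : ∀ i < p + 1, ∀ y, ∃ h : b i y ∈ A.domain, A ⟨_, h⟩ = b (i + 1) y)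
    {X Y : PowerSeries (H →L[ℂ] H)} (hX : IsTaylorSeries A X) (hY : IsTaylorSeries A Y)
    {c ε₀ : ℝ} (hc : 0 < c) (hε₀ : 0 < ε₀)
    (hV : ∀ ε ∈ Set.Icc 0 ε₀, ‖truncEval (p + 1) X ε‖ ≤ 1 - c * ε) :
    ∃ D : ℝ, 0 ≤ D ∧ ∀ m : ℕ, 1 ≤ m → ∀ x y : H,
      ‖⟪b 0 x, (PowerSeries.coeff 0 X ^ m * PowerSeries.coeff 0 Y) (b 0 y)⟫_ℂ‖ ≤
        D * (1 / (m : ℝ) ^ (p + 1)) * (‖x‖ * ‖y‖) := by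
  obtain ⟨F, hF0, hF⟩ := exists_norm_le_of_continuous (continuous_truncEval (p + 1) Y) 0 ε₀
  obtain ⟨P, hP0, hP⟩ := exists_norm_le_of_continuous (continuous_expTrunc b (p + 1)) (-ε₀) ε₀
  set kX := ‖PowerSeries.coeff (p + 1 + 1) X‖ with hkX
  set kY := ‖PowerSeries.coeff (p + 1 + 1) Y‖ with hkY
  -- constants in `‖y'‖ ≤ (a₁ ε ^ p + a₂ m ε ^ (p + 1)) e^{-cεm}`
  set a₁ : ℝ := 2 * ‖b (p + 1)‖ * F * P with ha₁
  set a₂ : ℝ := P * P * ((p + 2) * (Real.exp (c * ε₀) * kX * F + kY)) with ha₂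
  have ha₁0 : 0 ≤ a₁ := by positivity
  have ha₂0 : 0 ≤ a₂ := by positivity
  set g₁ : ℝ := p.factorial * (2 / c) ^ p
  set g₂ : ℝ := (p + 1).factorial * (2 / c) ^ (p + 1)
  set D₁ : ℝ := (a₁ * g₁ + a₂ * g₂) * (2 / c) with hD₁
  set D₂ : ℝ := P * P * F * ((p + 1).factorial * (1 / (c * ε₀)) ^ (p + 1)) with hD₂
  refine ⟨D₁ + D₂, by positivity, fun m hm x y => ?_⟩
  have hm0 : (0 : ℝ) < m := by exact_mod_cast hm
  set Q : ℝ → H →L[ℂ] H := fun ε => truncEval (p + 1) X ε ^ m * truncEval (p + 1) Y ε with hQ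
  set f : ℝ → ℂ := fun ε => ⟪expTrunc b (p + 1) ε x, Q ε (expTrunc b (p + 1) (-ε) y)⟫_ℂ with hf
  have hr0 : ∀ ε ∈ Set.Icc 0 ε₀, 0 ≤ 1 - c * ε := fun ε hε => (norm_nonneg _).trans (hV ε hε)
  have hrexp : ∀ ε, 1 - c * ε ≤ Real.exp (-(c * ε)) := fun ε => by
    have := Real.add_one_le_exp (-(c * ε)); linarith
  have hrm : ∀ ε ∈ Set.Icc 0 ε₀, (1 - c * ε) ^ m ≤ Real.exp (-(c * ε * m)) := by
    intro ε hε
    calc (1 - c * ε) ^ m ≤ Real.exp (-(c * ε)) ^ m :=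
          pow_le_pow_left₀ (hr0 ε hε) (hrexp ε) m
      _ = _ := by rw [← Real.exp_nat_mul]; congr 1; ring
  have hrm' : ∀ ε ∈ Set.Icc 0 ε₀,
      -- The factor e^{cε₀} pays for the one contraction missing in the defect of an m-th power.
      (1 - c * ε) ^ (m - 1) ≤ Real.exp (c * ε₀) * Real.exp (-(c * ε * m)) := by
    intro ε hε
    calc (1 - c * ε) ^ (m - 1) ≤ Real.exp (-(c * ε)) ^ (m - 1) :=
          pow_le_pow_left₀ (hr0 ε hε) (hrexp ε) _
      _ = Real.exp (c * ε + -(c * ε * m)) := by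
        rw [← Real.exp_nat_mul, Nat.cast_sub hm]; congr 1; push_cast; ring
      _ ≤ Real.exp (c * ε₀ + -(c * ε * m)) := by gcongr; exact hε.2
      _ = _ := Real.exp_add _ _
  have hVm : ∀ ε ∈ Set.Icc 0 ε₀, ‖truncEval (p + 1) X ε ^ m‖ ≤ Real.exp (-(c * ε * m)) :=
    fun ε hε => (norm_pow_le' _ hm).trans
      ((pow_le_pow_left₀ (norm_nonneg _) (hV ε hε) m).trans (hrm ε hε))
  have hQn : ∀ ε ∈ Set.Icc 0 ε₀, ‖Q ε‖ ≤ Real.exp (-(c * ε * m)) * F := fun ε hε =>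
    (norm_mul_le _ _).trans (mul_le_mul (hVm ε hε) (hF ε hε) (norm_nonneg _) (by positivity))
  have hPx : ∀ ε ∈ Set.Icc (-ε₀) ε₀, ∀ x, ‖expTrunc b (p + 1) ε x‖ ≤ P * ‖x‖ :=
    fun ε hε x => ((expTrunc b (p + 1) ε).le_opNorm x).trans (by gcongr; exact hP ε hε)
  have hmem : ∀ ε ∈ Set.Icc 0 ε₀, ε ∈ Set.Icc (-ε₀) ε₀ ∧ -ε ∈ Set.Icc (-ε₀) ε₀ :=
    fun ε hε => ⟨⟨by linarith [hε.1], hε.2⟩, ⟨by linarith [hε.2], by linarith [hε.1]⟩⟩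
  have hder : ∀ ε ∈ Set.Icc 0 ε₀, ∃ f', HasDerivAt f f' ε ∧
      ‖f'‖ ≤ (a₁ * (ε ^ p * Real.exp (-(c * ε * m))) +
        a₂ * (m * (ε ^ (p + 1) * Real.exp (-(c * ε * m))))) * (‖x‖ * ‖y‖) := by
    intro ε hε
    obtain ⟨X', hX'⟩ := isApproxFlow_truncEval hX (p + 1) ε
    obtain ⟨Y', hY'⟩ := isApproxFlow_truncEval hY (p + 1) ε
    obtain ⟨V', ρ, hV', hρ⟩ := hX'.pow hA (hV ε hε) m
    have hflow := hV'.mul hA hY'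
    refine ⟨_, hflow.hasDerivAt_pairing hb x y, ?_⟩
    set ρX := ((((p + 1 : ℕ) : ℂ) + 1) * (ε : ℂ) ^ (p + 1)) • PowerSeries.coeff (p + 1 + 1) X
    set ρY := ((((p + 1 : ℕ) : ℂ) + 1) * (ε : ℂ) ^ (p + 1)) • PowerSeries.coeff (p + 1 + 1) Y
    set E := Real.exp (-(c * ε * m)) with hE
    have hE0 : 0 < E := Real.exp_pos _
    have hρs : ∀ Z : H →L[ℂ] H, ‖((((p + 1 : ℕ) : ℂ) + 1) * (ε : ℂ) ^ (p + 1)) • Z‖ =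
        (p + 2) * ε ^ (p + 1) * ‖Z‖ := by
      intro Z
      have : ((((p + 1 : ℕ) : ℂ) + 1) * (ε : ℂ) ^ (p + 1)) =
          ((((p : ℝ) + 2) * ε ^ (p + 1) : ℝ) : ℂ) := by push_cast; ring
      rw [norm_smul, this, Complex.norm_real, Real.norm_of_nonneg]
      have := hε.1
      positivity
    have hε1 : 0 ≤ ε := hε.1
    have hm1 : (1 : ℝ) ≤ m := by exact_mod_cast hm
    have hρn : ‖ρ * truncEval (p + 1) Y ε + truncEval (p + 1) X ε ^ m * ρY‖ ≤
        (p + 2) * (Real.exp (c * ε₀) * kX * F + kY) * (m * (ε ^ (p + 1) * E)) := by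
      calc _ ≤ ‖ρ‖ * ‖truncEval (p + 1) Y ε‖ + ‖truncEval (p + 1) X ε ^ m‖ * ‖ρY‖ :=
            (norm_add_le _ _).trans (add_le_add (norm_mul_le _ _) (norm_mul_le _ _))
        _ ≤ (m * (Real.exp (c * ε₀) * E) * ((p + 2) * ε ^ (p + 1) * kX)) * F +
            E * ((p + 2) * ε ^ (p + 1) * kY) := by
          rw [hρs] at hρ ⊢
          gcongr
          · refine hρ.trans ?_
            gcongr
            exact hrm' ε hε
          · exact hF ε hε
          · exact hVm ε hε
        _ ≤ (m * (Real.exp (c * ε₀) * E) * ((p + 2) * ε ^ (p + 1) * kX)) * F +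
            m * (E * ((p + 2) * ε ^ (p + 1) * kY)) := by
          exact add_le_add le_rfl (le_mul_of_one_le_left (by positivity) hm1)
        _ = _ := by ring
    have hfac : (1 : ℝ) ≤ p.factorial := by exact_mod_cast p.factorial_pos
    have hts : ∀ (δ : ℝ), |δ| = ε → ∀ z : H,
        ‖((δ : ℂ) ^ p / (p.factorial : ℂ)) • b (p + 1) z‖ ≤ ε ^ p * (‖b (p + 1)‖ * ‖z‖) := by
      intro δ hδ z
      rw [norm_smul, norm_div, norm_pow, Complex.norm_real, Real.norm_eq_abs, hδ,
        Complex.norm_natCast]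
      have := (b (p + 1)).le_opNorm z
      have h2 : ε ^ p / p.factorial ≤ ε ^ p := div_le_self (by positivity) hfac
      gcongr
    have h1 : ‖⟪((ε : ℂ) ^ p / (p.factorial : ℂ)) • b (p + 1) x,
        Q ε (expTrunc b (p + 1) (-ε) y)⟫_ℂ‖ ≤
        ε ^ p * (‖b (p + 1)‖ * ‖x‖) * (E * F * (P * ‖y‖)) := by
      refine (norm_inner_le_norm _ _).trans ?_
      gcongr
      · exact hts ε (abs_of_nonneg hε1) x
      · refine ((Q ε).le_opNorm _).trans ?_
        gcongr
        · exact hQn ε hε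
        · exact hPx _ (hmem ε hε).2 y
    have h2 : ‖⟪expTrunc b (p + 1) ε x,
        Q ε ((((-ε : ℝ) : ℂ) ^ p / (p.factorial : ℂ)) • b (p + 1) y)⟫_ℂ‖ ≤
        P * ‖x‖ * (E * F * (ε ^ p * (‖b (p + 1)‖ * ‖y‖))) := by
      refine (norm_inner_le_norm _ _).trans ?_
      gcongr
      · exact hPx _ (hmem ε hε).1 x
      · refine ((Q ε).le_opNorm _).trans ?_
        gcongr
        · exact hQn ε hε
        · exact hts (-ε) (by rw [abs_neg, abs_of_nonneg hε1]) y
    have h3 : ‖⟪expTrunc b (p + 1) ε x,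
        (ρ * truncEval (p + 1) Y ε + truncEval (p + 1) X ε ^ m * ρY)
          (expTrunc b (p + 1) (-ε) y)⟫_ℂ‖ ≤
        P * ‖x‖ * ((p + 2) * (Real.exp (c * ε₀) * kX * F + kY) * (m * (ε ^ (p + 1) * E)) *
          (P * ‖y‖)) := by
      refine (norm_inner_le_norm _ _).trans ?_
      gcongr
      · exact hPx _ (hmem ε hε).1 x
      · refine (ContinuousLinearMap.le_opNorm _ _).trans ?_
        gcongr
        exact hPx _ (hmem ε hε).2 y
    refine (norm_sub_le _ _).trans ((add_le_add ((norm_add_le _ _).trans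
      (add_le_add (norm_neg _).le le_rfl)) le_rfl).trans ?_)
    refine (add_le_add (add_le_add h1 h2) h3).trans (le_of_eq ?_)
    rw [ha₁, ha₂]
    ring
  choose! f' hf' hf'n using hder
  set κ : ℝ := c / 2 * m with hκ
  have hκ0 : 0 < κ := by positivity
  set G : ℝ := (a₁ * g₁ + a₂ * g₂) * (1 / (m : ℝ) ^ p) * (‖x‖ * ‖y‖) with hG
  have hG0 : 0 ≤ G := by positivity
  have hbound : ∀ ε ∈ Set.Icc 0 ε₀, ‖f' ε‖ ≤ G * Real.exp (-(κ * ε)) := by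
    intro ε hε
    refine (hf'n ε hε).trans ?_
    have h1 := pow_mul_exp_le hc hm0 hε.1 p
    have h2 := mul_le_mul_of_nonneg_left (pow_mul_exp_le hc hm0 hε.1 (p + 1)) hm0.le
    have h3 : (m : ℝ) * ((p + 1).factorial * (2 / c) ^ (p + 1) * (1 / (m : ℝ) ^ (p + 1)) *
        Real.exp (-(c / 2 * m * ε))) =
        g₂ * (1 / (m : ℝ) ^ p) * Real.exp (-(c / 2 * m * ε)) := by
      simp only [g₂]
      rw [pow_succ (m : ℝ)]
      field_simp
    rw [h3] at h2
    calc _ ≤ (a₁ * (g₁ * (1 / (m : ℝ) ^ p) * Real.exp (-(c / 2 * m * ε))) +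
          a₂ * (g₂ * (1 / (m : ℝ) ^ p) * Real.exp (-(c / 2 * m * ε)))) * (‖x‖ * ‖y‖) := by
          gcongr
      _ = _ := by rw [hG, hκ]; ring
  -- A primitive of the bound on the derivative, vanishing at 0 and at most G/κ. As κ = cm/2, this
  -- supplies the last factor 1/m.
  have hB : ∀ ε, HasDerivAt (fun ε => G / κ * (1 - Real.exp (-(κ * ε))))
      (G * Real.exp (-(κ * ε))) ε := by
    intro ε
    have h1 : HasDerivAt (fun ε => -(κ * ε)) (-κ) ε := by
      have h := ((hasDerivAt_id ε).const_mul κ).neg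
      rw [mul_one] at h
      exact h
    refine ((h1.exp.const_sub 1).const_mul (G / κ)).congr_deriv ?_
    field_simp
  have hfc : ∀ ε ∈ Set.Icc 0 ε₀, HasDerivAt (fun ε => f ε - f 0) (f' ε) ε :=
    fun ε hε => (hf' ε hε).sub_const _
  have hfin := image_norm_le_of_norm_deriv_right_le_deriv_boundary
    (f := fun ε => f ε - f 0) (f' := f') (a := 0) (b := ε₀)
    (fun ε hε => (hfc ε hε).continuousAt.continuousWithinAt)
    (fun ε hε => (hfc ε ⟨hε.1, hε.2.le⟩).hasDerivWithinAt)
    (by simp) hB (fun ε hε => hbound ε ⟨hε.1, hε.2.le⟩)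
    (Set.right_mem_Icc.mpr hε₀.le)
  have hGκ : G / κ = D₁ * (1 / (m : ℝ) ^ (p + 1)) * (‖x‖ * ‖y‖) := by
    rw [hG, hκ, hD₁, pow_succ (m : ℝ)]
    field_simp
  have hfin' : ‖f ε₀ - f 0‖ ≤ D₁ * (1 / (m : ℝ) ^ (p + 1)) * (‖x‖ * ‖y‖) := by
    refine hfin.trans ?_
    rw [← hGκ]
    exact mul_le_of_le_one_right (by positivity) (by linarith [Real.exp_pos (-(κ * ε₀))])
  have hε₀m : ε₀ ∈ Set.Icc 0 ε₀ := Set.right_mem_Icc.mpr hε₀.le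
  have hend : ‖f ε₀‖ ≤ D₂ * (1 / (m : ℝ) ^ (p + 1)) * (‖x‖ * ‖y‖) := by
    have h1 : Real.exp (-(c * ε₀ * m)) ≤
        (p + 1).factorial * (1 / (c * ε₀)) ^ (p + 1) * (1 / (m : ℝ) ^ (p + 1)) := by
      have h2 := Real.pow_div_factorial_le_exp (c * ε₀ * m) (by positivity) (p + 1)
      have hq : (0 : ℝ) < (p + 1).factorial := by exact_mod_cast (p + 1).factorial_pos
      rw [Real.exp_neg]
      refine (inv_anti₀ (by positivity) h2).trans (le_of_eq ?_)
      rw [mul_pow, one_div_pow]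
      field_simp
    calc ‖f ε₀‖ ≤ P * ‖x‖ * (Real.exp (-(c * ε₀ * m)) * F * (P * ‖y‖)) := by
          refine (norm_inner_le_norm _ _).trans ?_
          gcongr
          · exact hPx _ (hmem ε₀ hε₀m).1 x
          · refine ((Q ε₀).le_opNorm _).trans ?_
            gcongr
            · exact hQn ε₀ hε₀m
            · exact hPx _ (hmem ε₀ hε₀m).2 y
      _ ≤ P * ‖x‖ * (((p + 1).factorial * (1 / (c * ε₀)) ^ (p + 1) *
            (1 / (m : ℝ) ^ (p + 1))) * F * (P * ‖y‖)) := by gcongr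
      _ = _ := by rw [hD₂]; ring
  have hf0 : f 0 = ⟪b 0 x, (PowerSeries.coeff 0 X ^ m * PowerSeries.coeff 0 Y) (b 0 y)⟫_ℂ := by
    have h1 : ∀ Z : PowerSeries (H →L[ℂ] H),
        truncEval (p + 1) Z 0 = PowerSeries.coeff 0 Z := by
      intro Z
      rw [truncEval, Finset.sum_range_succ']
      simp
    have h2 : expTrunc b (p + 1) 0 = b 0 := by
      rw [expTrunc, Finset.sum_range_succ']
      simp
    simp only [hf, hQ, neg_zero, h1, h2]
  rw [← hf0]
  calc ‖f 0‖ = ‖f ε₀ - (f ε₀ - f 0)‖ := by rw [sub_sub_cancel]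
    _ ≤ ‖f ε₀‖ + ‖f ε₀ - f 0‖ := norm_sub_le _ _
    _ ≤ _ := by
      refine (add_le_add hend hfin').trans (le_of_eq ?_)
      ring

theorem exists_norm_invSqAddOne_pow_le (hA : IsSelfAdjoint A) {n : ℕ} (hn : 1 ≤ n)
    {X Y : PowerSeries (H →L[ℂ] H)} (hX : IsTaylorSeries A X) (hY : IsTaylorSeries A Y)
    {c ε₀ : ℝ} (hc : 0 < c) (hε₀ : 0 < ε₀)
    (hV : ∀ ε ∈ Set.Icc 0 ε₀, ‖truncEval (2 * n) X ε‖ ≤ 1 - c * ε) :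
    ∃ D : ℝ, 0 ≤ D ∧ ∀ m : ℕ, 1 ≤ m →
      ‖invSqAddOne A ^ n * (PowerSeries.coeff 0 X ^ m * PowerSeries.coeff 0 Y) *
        invSqAddOne A ^ n‖ ≤ D * (1 / (m : ℝ) ^ (2 * n)) := by
  obtain ⟨b, hb0, hb⟩ := exists_weights hA n
  -- The last bounded weight is A^{2n} (A² + 1)⁻ⁿ, so 2n terms of the exponential can be kept and A
  -- still applied to each of them.
  obtain ⟨p, hp⟩ : ∃ p, 2 * n = p + 1 := ⟨2 * n - 1, by omega⟩
  rw [hp] at hb hV ⊢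
  obtain ⟨D, hD0, hD⟩ := exists_norm_pairing_le hA hb hX hY hc hε₀ hV
  refine ⟨D, hD0, fun m hm => ?_⟩
  have hsa : star (invSqAddOne A ^ n) = invSqAddOne A ^ n := by
    rw [star_pow, (IsSelfAdjoint.of_nonneg (invSqAddOne_nonneg hA)).star_eq]
  refine ContinuousLinearMap.opNorm_le_bound _ (by positivity) fun y => ?_
  set Z := PowerSeries.coeff 0 X ^ m * PowerSeries.coeff 0 Y
  set w := (invSqAddOne A ^ n * Z * invSqAddOne A ^ n) y with hw
  -- Testing against w itself turns the form bound into ‖w‖² ≤ const · ‖w‖ ‖y‖, from which one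
  -- factor ‖w‖ is cancelled.
  have h1 := hD m hm w y
  have h2 : ⟪b 0 w, Z (b 0 y)⟫_ℂ = ⟪w, w⟫_ℂ := by
    rw [hb0, ← ContinuousLinearMap.adjoint_inner_right, ← ContinuousLinearMap.star_eq_adjoint, hsa]
    rfl
  rw [h2, inner_self_eq_norm_sq_to_K, norm_pow, RCLike.norm_ofReal, abs_norm] at h1
  rcases (norm_nonneg w).eq_or_lt with h0 | h0
  · rw [← h0]; positivity
  · refine le_of_mul_le_mul_right ?_ h0
    calc ‖w‖ * ‖w‖ = ‖w‖ ^ 2 := by ring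
      _ ≤ _ := h1
      _ = _ := by ring

end Decay

/-! ### Interpolation between weights -/

section Interpolation

/-- ST and TS have the same nonzero spectrum. -/
theorem spectralRadius_mul_le_mul_comm (S T : H →L[ℂ] H) :
    spectralRadius ℂ (S * T) ≤ spectralRadius ℂ (T * S) := by
  refine iSup₂_le fun k hk => ?_
  rcases eq_or_ne k 0 with rfl | h0
  · simp
  · have h1 : k ∈ spectrum ℂ (T * S) \ {0} := by
      rw [← spectrum.nonzero_mul_comm]; exact ⟨hk, h0⟩
    exact le_iSup₂ (f := fun (k : ℂ) (_ : k ∈ spectrum ℂ (T * S)) => (‖k‖₊ : ENNReal)) k h1.1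

/-- The left side is the spectral radius of the self-adjoint operator bT*b²Tb. Moving the first b to
the end by cyclicity gives T*(b²Tb²), whose spectral radius is at most its norm. -/
theorem norm_mul_mul_sq_le {b : H →L[ℂ] H} (hb : IsSelfAdjoint b) (T : H →L[ℂ] H) :
    ‖b * T * b‖ ^ 2 ≤ ‖T‖ * ‖(b * b) * T * (b * b)‖ := by
  rcases subsingleton_or_nontrivial H with hH | hH
  · rw [Subsingleton.elim (b * T * b) 0]
    simp
  · have h1 : star (b * T * b) * (b * T * b) = b * (star T * (b * b) * T * b) := by
      rw [star_mul, star_mul, hb.star_eq]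
      noncomm_ring
    have h2 : spectralRadius ℂ (star (b * T * b) * (b * T * b)) ≤
        (‖star T * ((b * b) * T * (b * b))‖₊ : ENNReal) := by
      rw [h1]
      refine (spectralRadius_mul_le_mul_comm _ _).trans ?_
      have h3 : star T * (b * b) * T * b * b = star T * ((b * b) * T * (b * b)) := by
        noncomm_ring
      rw [h3]
      exact spectrum.spectralRadius_le_nnnorm _
    rw [(IsSelfAdjoint.star_mul_self (b * T * b)).spectralRadius_eq_nnnorm,
      ENNReal.coe_le_coe] at h2
    have h4 : ‖star (b * T * b) * (b * T * b)‖ ≤ ‖star T * ((b * b) * T * (b * b))‖ := h2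
    rw [CStarRing.norm_star_mul_self] at h4
    calc ‖b * T * b‖ ^ 2 = ‖b * T * b‖ * ‖b * T * b‖ := sq _
      _ ≤ _ := h4
      _ ≤ ‖star T‖ * ‖(b * b) * T * (b * b)‖ := norm_mul_le _ _
      _ = _ := by rw [norm_star]

variable {A : H →ₗ.[ℂ] H}

/-- For unbounded A the operator (A² + 1)⁻¹ has 0 in its spectrum. Powers with positive exponents
satisfy the semigroup law without invertibility, hence the detour through nonnegative real
exponents. -/
theorem bracketNegPow_add {s t : ℝ} (hs : 0 < s) (ht : 0 < t) :
    bracketNegPow A (s + t) = bracketNegPow A s * bracketNegPow A t := by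
  have key : ∀ s : ℝ, 0 < s →
      bracketNegPow A s = invSqAddOne A ^ (Real.toNNReal (s / 2)) := by
    intro s hs
    have h1 : 0 < Real.toNNReal (s / 2) := Real.toNNReal_pos.mpr (by linarith)
    rw [CFC.nnrpow_eq_rpow h1, Real.coe_toNNReal _ (by linarith)]
    rfl
  rw [key _ hs, key _ ht, key _ (add_pos hs ht), add_div,
    Real.toNNReal_add (by linarith) (by linarith)]
  exact CFC.nnrpow_add (Real.toNNReal_pos.mpr (by linarith)) (Real.toNNReal_pos.mpr (by linarith))

theorem isSelfAdjoint_bracketNegPow (s : ℝ) : IsSelfAdjoint (bracketNegPow A s) :=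
  IsSelfAdjoint.of_nonneg CFC.rpow_nonneg

theorem bracketNegPow_two_mul (hA : IsSelfAdjoint A) (n : ℕ) :
    bracketNegPow A (2 * n) = invSqAddOne A ^ n := by
  rw [bracketNegPow, mul_div_cancel_left₀ (n : ℝ) two_ne_zero]
  exact CFC.rpow_natCast _ _ (invSqAddOne_nonneg hA)

/-- The operators `T m` decay with exponent `q` between the weights `⟨A⟩ ^ (-s)`. -/
def HasDecay (A : H →ₗ.[ℂ] H) (T : ℕ → H →L[ℂ] H) (s q : ℝ) : Prop :=
  ∃ D : ℝ, 0 ≤ D ∧ ∀ m : ℕ, 1 ≤ m →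
    ‖bracketNegPow A s * T m * bracketNegPow A s‖ ≤ D * (m : ℝ) ^ (-q)

variable {T : ℕ → H →L[ℂ] H} {s t q q' : ℝ}

theorem HasDecay.mono_exponent (h : HasDecay A T s q) (hq : q' ≤ q) : HasDecay A T s q' := by
  obtain ⟨D, hD0, hD⟩ := h
  refine ⟨D, hD0, fun m hm => (hD m hm).trans ?_⟩
  have hm1 : (1 : ℝ) ≤ m := by exact_mod_cast hm
  gcongr

theorem HasDecay.mono_weight (h : HasDecay A T s q) (hs : 0 < s) (hst : s ≤ t) :
    HasDecay A T t q := by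
  rcases hst.eq_or_lt with rfl | hst
  · exact h
  obtain ⟨D, hD0, hD⟩ := h
  set N := ‖bracketNegPow A (t - s)‖
  refine ⟨N * D * N, by positivity, fun m hm => ?_⟩
  have h1 : bracketNegPow A t = bracketNegPow A (t - s) * bracketNegPow A s := by
    rw [← bracketNegPow_add (sub_pos.mpr hst) hs, sub_add_cancel]
  have h2 : bracketNegPow A t = bracketNegPow A s * bracketNegPow A (t - s) := by
    rw [← bracketNegPow_add hs (sub_pos.mpr hst), add_sub_cancel]
  have h3 : bracketNegPow A t * T m * bracketNegPow A t = bracketNegPow A (t - s) *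
      (bracketNegPow A s * T m * bracketNegPow A s) * bracketNegPow A (t - s) := by
    nth_rewrite 1 [h1]
    rw [h2]
    noncomm_ring
  rw [h3]
  calc _ ≤ N * ‖bracketNegPow A s * T m * bracketNegPow A s‖ * N :=
        (norm_mul_le _ _).trans (by gcongr; exact norm_mul_le _ _)
    _ ≤ N * (D * (m : ℝ) ^ (-q)) * N := by gcongr; exact hD m hm
    _ = _ := by ring

/-- Interpolation with the trivial weight-free bound ‖T m‖ ≤ K, with b = ⟨A⟩^{-s} and b² =
⟨A⟩^{-2s}: weight and exponent are halved together. -/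
theorem HasDecay.halve {K : ℝ} (hT : ∀ m, ‖T m‖ ≤ K) (hs : 0 < s)
    (h : HasDecay A T (2 * s) (2 * q)) : HasDecay A T s q := by
  obtain ⟨D, hD0, hD⟩ := h
  have hK : 0 ≤ K := (norm_nonneg _).trans (hT 0)
  refine ⟨√(K * D), by positivity, fun m hm => ?_⟩
  have hm0 : (0 : ℝ) < m := by exact_mod_cast hm
  have h1 := norm_mul_mul_sq_le (isSelfAdjoint_bracketNegPow (A := A) s) (T m)
  rw [← bracketNegPow_add hs hs, ← two_mul] at h1
  refine abs_le_of_sq_le_sq' ?_ (by positivity) |>.2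
  calc _ ≤ ‖T m‖ * ‖bracketNegPow A (2 * s) * T m * bracketNegPow A (2 * s)‖ := h1
    _ ≤ K * (D * (m : ℝ) ^ (-(2 * q))) := by gcongr; exacts [hT m, hD m hm]
    _ = (√(K * D) * (m : ℝ) ^ (-q)) ^ 2 := by
      rw [mul_pow, Real.sq_sqrt (by positivity), ← Real.rpow_natCast ((m : ℝ) ^ (-q)),
        ← Real.rpow_mul hm0.le, mul_assoc]
      congr 3
      push_cast
      ring

theorem HasDecay.halve_iterate {K : ℝ} (hT : ∀ m, ‖T m‖ ≤ K) (hs : 0 < s) (i : ℕ)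
    (h : HasDecay A T (2 ^ i * s) (2 ^ i * q)) : HasDecay A T s q := by
  induction i with
  | zero => simpa using h
  | succ i ih =>
    rw [pow_succ', mul_assoc, mul_assoc] at h
    exact ih (h.halve hT (by positivity))

theorem hasDecay_of_forall_even {K : ℝ} (hT : ∀ m, ‖T m‖ ≤ K)
    (h : ∀ n : ℕ, 1 ≤ n → HasDecay A T (2 * n) (2 * n)) (hs : 0 < s) (hq : q < s) :
    HasDecay A T s q := by
  -- After scaling by 2^i, the gap between s and q exceeds 2, so it contains an even integer 2n; the
  -- term 2 / s ensures n ≥ 1.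
  obtain ⟨i, hi⟩ := pow_unbounded_of_one_lt (2 / (s - q) + 2 / s) (one_lt_two (α := ℝ))
  have hsq : 0 < s - q := sub_pos.mpr hq
  have h1 : 2 < 2 ^ i * (s - q) := by
    rw [← div_lt_iff₀ hsq]
    have : 0 < 2 / s := by positivity
    linarith
  have h2 : 2 < 2 ^ i * s := by
    rw [← div_lt_iff₀ hs]
    have : 0 < 2 / (s - q) := by positivity
    linarith
  set n := ⌊2 ^ i * s / 2⌋₊ with hn
  have hn1 : 1 ≤ n := Nat.le_floor (by push_cast; linarith)
  have h3 : (n : ℝ) ≤ 2 ^ i * s / 2 := Nat.floor_le (by positivity)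
  have h4 : 2 ^ i * s / 2 < n + 1 := Nat.lt_floor_add_one _
  have hn0 : (0 : ℝ) < n := by exact_mod_cast hn1
  exact (((h n hn1).mono_weight (by positivity) (t := 2 ^ i * s) (by linarith)).mono_exponent
    (q' := 2 ^ i * q) (by linarith)).halve_iterate hT hs i

end Interpolation

/-! ### Fourier expansion of smooth functions on the circle -/

section Fourier

theorem periodic_deriv {f : ℝ → ℂ} {T : ℝ} (hf : Function.Periodic f T) :
    Function.Periodic (deriv f) T := by
  intro x
  rw [← deriv_comp_add_const f T x]
  congr 1
  exact funext hf

theorem periodic_iterate_deriv {f : ℝ → ℂ} {T : ℝ} (hf : Function.Periodic f T) (k : ℕ) :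
    Function.Periodic (deriv^[k] f) T := by
  induction k with
  | zero => exact hf
  | succ k ih => rw [Function.iterate_succ_apply']; exact periodic_deriv ih

theorem hasDerivAt_cexp_int (n : ℤ) (x : ℝ) :
    HasDerivAt (fun x : ℝ => Complex.exp (-(n * x * Complex.I)))
      (-(n * Complex.I) * Complex.exp (-(n * x * Complex.I))) x := by
  have h1 : HasDerivAt (fun z : ℂ => -((n : ℂ) * z * Complex.I)) (-(n * Complex.I)) (x : ℂ) := by
    have h := (((hasDerivAt_id (x : ℂ)).const_mul (n : ℂ)).mul_const Complex.I).neg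
    rw [mul_one] at h
    exact h
  have h2 := h1.cexp.comp_ofReal
  rwa [mul_comm] at h2

theorem integral_cexp_mul_deriv {f : ℝ → ℂ} (hf : ContDiff ℝ ∞ f)
    (hp : Function.Periodic f (2 * Real.pi)) (n : ℤ) :
    ∫ x in (0 : ℝ)..2 * Real.pi, Complex.exp (-(n * x * Complex.I)) * deriv f x =
      n * Complex.I *
        ∫ x in (0 : ℝ)..2 * Real.pi, Complex.exp (-(n * x * Complex.I)) * f x := by
  have hf' := contDiff_infty_iff_deriv.mp hf
  rw [intervalIntegral.integral_mul_deriv_eq_deriv_mul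
    (fun x _ => hasDerivAt_cexp_int n x) (fun x _ => (hf'.1 x).hasDerivAt)
    (Continuous.intervalIntegrable (by fun_prop) _ _)
    (hf'.2.continuous.intervalIntegrable _ _), ← intervalIntegral.integral_const_mul]
  have h1 : f (2 * Real.pi) = f 0 := by simpa using hp 0
  have h2 : Complex.exp (-(n * ((2 * Real.pi : ℝ) : ℂ) * Complex.I)) = 1 := by
    rw [Complex.exp_neg, inv_eq_one, Complex.exp_eq_one_iff]
    exact ⟨n, by push_cast; ring⟩
  rw [h1, h2]
  simp only [Complex.ofReal_zero, mul_zero, zero_mul, neg_zero, Complex.exp_zero, sub_self,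
    zero_sub]
  rw [← intervalIntegral.integral_neg]
  congr 1
  ext x
  ring

theorem integral_cexp_mul_iterate_deriv {f : ℝ → ℂ} (hf : ContDiff ℝ ∞ f)
    (hp : Function.Periodic f (2 * Real.pi)) (n : ℤ) (k : ℕ) :
    ∫ x in (0 : ℝ)..2 * Real.pi, Complex.exp (-(n * x * Complex.I)) * (deriv^[k] f) x =
      (n * Complex.I) ^ k *
        ∫ x in (0 : ℝ)..2 * Real.pi, Complex.exp (-(n * x * Complex.I)) * f x := by
  induction k with
  | zero => simp
  | succ k ih =>
    rw [Function.iterate_succ_apply', integral_cexp_mul_deriv (hf.iterate_deriv k)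
      (periodic_iterate_deriv hp k), ih]
    ring

theorem exists_norm_fourier_integral_le {f : ℝ → ℂ} (hf : ContDiff ℝ ∞ f)
    (hp : Function.Periodic f (2 * Real.pi)) (k : ℕ) :
    ∃ M : ℝ, ∀ n : ℤ, |(n : ℝ)| ^ k *
      ‖∫ x in (0 : ℝ)..2 * Real.pi, Complex.exp (-(n * x * Complex.I)) * f x‖ ≤ M := by
  obtain ⟨C, hC⟩ := isCompact_Icc.exists_bound_of_continuousOn
    (hf.iterate_deriv k).continuous.continuousOn (s := Set.Icc 0 (2 * Real.pi))
  refine ⟨C * |2 * Real.pi - 0|, fun n => ?_⟩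
  have h1 := congrArg norm (integral_cexp_mul_iterate_deriv hf hp n k)
  rw [norm_mul, norm_pow, norm_mul, Complex.norm_I, mul_one, Complex.norm_intCast] at h1
  rw [← h1]
  refine intervalIntegral.norm_integral_le_of_norm_le_const fun x hx => ?_
  rw [Set.uIoc_of_le Real.two_pi_pos.le] at hx
  have h2 : ‖Complex.exp (-(n * x * Complex.I))‖ = 1 := by
    rw [Complex.norm_exp]; simp
  rw [norm_mul, h2, one_mul]
  exact hC x ⟨hx.1.le, hx.2⟩

/-- The function `z ↦ z ^ n` on the circle. -/
def circleZPow (n : ℤ) : C(Circle, ℂ) where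
  toFun z := ((z ^ n : Circle) : ℂ)
  continuous_toFun := continuous_subtype_val.comp (continuous_zpow n)

/-- Repeated integration by parts makes the Fourier coefficients decay faster than any power, which
is what polynomially growing Taylor coefficients of U^n can be summed against. -/
theorem exists_hasSum_circleZPow {Φ : C(Circle, ℂ)}
    (hΦ : ContDiff ℝ ∞ (fun θ : ℝ => Φ (Circle.exp θ))) :
    ∃ c : ℤ → ℂ, (∀ j : ℕ, Summable fun n => ‖c n‖ * (n.natAbs + 1 : ℝ) ^ j) ∧
      HasSum (fun n => c n • circleZPow n) Φ := by
  have hT : Fact (0 < 2 * Real.pi) := ⟨Real.two_pi_pos⟩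
  set e : C(AddCircle (2 * Real.pi), Circle) :=
    ⟨AddCircle.homeomorphCircle', AddCircle.homeomorphCircle'.continuous⟩ with he
  set f : C(AddCircle (2 * Real.pi), ℂ) := Φ.comp e with hf
  have hp : Function.Periodic (fun θ : ℝ => Φ (Circle.exp θ)) (2 * Real.pi) := fun θ =>
    congrArg Φ (Circle.periodic_exp θ)
  have hexp : ∀ (n : ℤ) (x : ℝ), fourier n (x : AddCircle (2 * Real.pi)) =
      Complex.exp (n * x * Complex.I) := by
    intro n x
    rw [fourier_coe_apply]
    congr 1
    push_cast
    field_simp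
  have hcoeff : ∀ n : ℤ, fourierCoeff f n = (1 / (2 * Real.pi)) •
      ∫ x in (0 : ℝ)..2 * Real.pi, Complex.exp (-(n * x * Complex.I)) * Φ (Circle.exp x) := by
    intro n
    rw [fourierCoeff_eq_intervalIntegral _ _ 0, zero_add]
    congr 1
    refine intervalIntegral.integral_congr fun x _ => ?_
    have hfx : f (x : AddCircle (2 * Real.pi)) = Φ (Circle.exp x) := rfl
    simp only [hexp, smul_eq_mul, hfx]
    congr 2
    push_cast
    ring
  have hsum : ∀ j : ℕ, Summable fun n => ‖fourierCoeff f n‖ * (n.natAbs + 1 : ℝ) ^ j := by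
    intro j
    -- Two derivatives beyond j leave the summable factor 1/n².
    obtain ⟨M, hM⟩ := exists_norm_fourier_integral_le hΦ hp (j + 2)
    have hs : Summable fun n : ℤ => (1 / (2 * Real.pi) * M * 2 ^ j) * (1 / (n : ℝ) ^ 2) :=
      (Real.summable_one_div_int_pow.mpr one_lt_two).mul_left _
    refine hs.of_norm_bounded_eventually ?_
    have hfin : ∀ᶠ n : ℤ in Filter.cofinite, n ≠ 0 :=
      (Set.finite_singleton (0 : ℤ)).compl_mem_cofinite
    filter_upwards [hfin] with n hn
    have hn1 : (1 : ℝ) ≤ n.natAbs := by exact_mod_cast Int.natAbs_pos.mpr hn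
    have habs : |(n : ℝ)| = n.natAbs := by rw [Nat.cast_natAbs, Int.cast_abs]
    have h1 := hM n
    rw [habs] at h1
    have h2 : (n : ℝ) ^ 2 = (n.natAbs : ℝ) ^ 2 := by rw [← habs, sq_abs]
    rw [Real.norm_of_nonneg (by positivity), hcoeff, norm_smul,
      Real.norm_of_nonneg (by positivity), h2]
    set J := ‖∫ x in (0 : ℝ)..2 * Real.pi, Complex.exp (-(n * x * Complex.I)) * Φ (Circle.exp x)‖
    have hN : (0 : ℝ) < (n.natAbs : ℝ) ^ 2 := by positivity
    rw [mul_one_div, le_div_iff₀ hN]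
    have h3 : (n.natAbs + 1 : ℝ) ^ j ≤ (2 * n.natAbs : ℝ) ^ j := by
      gcongr; linarith
    have hJ : 0 ≤ J := norm_nonneg _
    calc 1 / (2 * Real.pi) * J * (n.natAbs + 1 : ℝ) ^ j * (n.natAbs : ℝ) ^ 2
        ≤ 1 / (2 * Real.pi) * J * (2 * n.natAbs : ℝ) ^ j * (n.natAbs : ℝ) ^ 2 := by gcongr
      _ = 1 / (2 * Real.pi) * ((n.natAbs : ℝ) ^ (j + 2) * J) * 2 ^ j := by
        rw [mul_pow, pow_add]; ring
      _ ≤ _ := by gcongr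
  refine ⟨fourierCoeff f, hsum, ?_⟩
  have h0 : Summable (fourierCoeff f) := by
    have := hsum 0
    simp only [pow_zero, mul_one] at this
    exact this.of_norm
  have h1 := hasSum_fourier_series_of_summable h0
  let E : C(Circle, AddCircle (2 * Real.pi)) :=
    ⟨AddCircle.homeomorphCircle'.symm, AddCircle.homeomorphCircle'.symm.continuous⟩
  have h2 := (ContinuousMap.compRightContinuousMap ℂ E).continuous
  have h3 := h1.map (ContinuousMap.compRightAlgHom ℂ ℂ E) h2
  convert h3 using 1
  · ext n z
    simp only [Function.comp_apply, ContinuousMap.smul_apply, circleZPow, ContinuousMap.coe_mk,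
      ContinuousMap.compRightAlgHom_apply, ContinuousMap.comp_apply, fourier_apply,
      AddCircle.toCircle_zsmul]
    congr 3
    obtain ⟨x, rfl⟩ := AddCircle.homeomorphCircle'.surjective z
    have : E (AddCircle.homeomorphCircle' x) = x := AddCircle.homeomorphCircle'.symm_apply_apply x
    rw [this]
    induction x using QuotientAddGroup.induction_on with
    | H x =>
      rw [AddCircle.toCircle_apply_mk]
      change Circle.exp x = _
      congr 1
      field_simp
  · ext z
    simp only [ContinuousMap.compRightAlgHom_apply, ContinuousMap.comp_apply, hf]
    congr 1
    exact (AddCircle.homeomorphCircle'.apply_symm_apply z).symm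

end Fourier

/-! ### Smooth functions of `U` -/

section FunCalc

theorem funCalc_circleZPow_one (U : unitary (H →L[ℂ] H)) :
    funCalc U (circleZPow 1) = (U : H →L[ℂ] H) := by
  have h1 : (circleZPow 1).comp (spectrumToCircle U) =
      ContinuousMap.restrict (spectrum ℂ (U : H →L[ℂ] H)) (ContinuousMap.id ℂ) := by
    ext z
    simp only [circleZPow, zpow_one, ContinuousMap.comp_apply, ContinuousMap.coe_mk]
    rfl
  change cfcHom _ ((circleZPow 1).comp (spectrumToCircle U)) = _
  rw [h1]
  exact cfcHom_id _

theorem circleZPow_natCast (n : ℕ) : circleZPow n = circleZPow 1 ^ n := by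
  ext z; simp [circleZPow]

theorem circleZPow_neg_natCast (n : ℕ) : circleZPow (-n) = star (circleZPow 1) ^ n := by
  ext z
  simp [circleZPow, ← Circle.coe_inv_eq_conj]

theorem funCalc_circleZPow_natCast (U : unitary (H →L[ℂ] H)) (n : ℕ) :
    funCalc U (circleZPow n) = (U : H →L[ℂ] H) ^ n := by
  rw [circleZPow_natCast, map_pow, funCalc_circleZPow_one]

theorem funCalc_circleZPow_neg_natCast (U : unitary (H →L[ℂ] H)) (n : ℕ) :
    funCalc U (circleZPow (-n)) = star (U : H →L[ℂ] H) ^ n := by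
  rw [circleZPow_neg_natCast, map_pow, map_star, funCalc_circleZPow_one]

theorem norm_unitary_le_one (U : unitary (H →L[ℂ] H)) : ‖(U : H →L[ℂ] H)‖ ≤ 1 := by
  rcases subsingleton_or_nontrivial H with hH | hH
  · rw [Subsingleton.elim (U : H →L[ℂ] H) 0]; simp
  · exact (CStarRing.norm_coe_unitary U).le

theorem norm_funCalc_le (U : unitary (H →L[ℂ] H)) (f : C(Circle, ℂ)) :
    ‖funCalc U f‖ ≤ ‖f‖ :=
  NonUnitalStarAlgHom.norm_apply_le (funCalc U) f

variable {A : H →ₗ.[ℂ] H}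

/-- A smooth function of an operator `U` of class `C^∞(A)` is of class `C^∞(A)`. -/
theorem exists_isTaylorSeries_funCalc (hA : IsSelfAdjoint A) {U : unitary (H →L[ℂ] H)}
    {X : PowerSeries (H →L[ℂ] H)} (hX : IsTaylorSeries A X)
    (hX0 : PowerSeries.coeff 0 X = (U : H →L[ℂ] H)) {Φ : C(Circle, ℂ)}
    (hΦ : ContDiff ℝ ∞ (fun θ : ℝ => Φ (Circle.exp θ))) :
    ∃ Y, IsTaylorSeries A Y ∧ PowerSeries.coeff 0 Y = funCalc U Φ := by
  obtain ⟨c, hc, hsum⟩ := exists_hasSum_circleZPow hΦ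
  set S := starSeries X with hS
  have hS0 : PowerSeries.coeff 0 S = star (U : H →L[ℂ] H) := by
    simp [hS, starSeries, hX0]
  -- Negative powers of U are powers of U*, so their Taylor series are powers of the adjoint series.
  let P : ℤ → PowerSeries (H →L[ℂ] H) := fun n =>
    if 0 ≤ n then X ^ n.natAbs else S ^ n.natAbs
  have hP : ∀ n, IsTaylorSeries A (P n) := by
    intro n
    simp only [P]
    split_ifs
    · exact hX.pow hA _
    · exact hX.star.pow hA _
  have hcoeff0 : ∀ (Z : PowerSeries (H →L[ℂ] H)) (n : ℕ),
      PowerSeries.coeff 0 (Z ^ n) = PowerSeries.coeff 0 Z ^ n := by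
    intro Z n
    simp [PowerSeries.coeff_zero_eq_constantCoeff]
  have hP0 : ∀ n, PowerSeries.coeff 0 (P n) = funCalc U (circleZPow n) := by
    intro n
    simp only [P]
    split_ifs with h
    · rw [hcoeff0, hX0, ← funCalc_circleZPow_natCast, Int.natAbs_of_nonneg h]
    · rw [hcoeff0, hS0, ← funCalc_circleZPow_neg_natCast, Int.ofNat_natAbs_of_nonpos (by omega),
        neg_neg]
  have hPn : ∀ j, ∃ C : ℝ, 0 ≤ C ∧ ∀ n : ℤ,
      ‖PowerSeries.coeff j (P n)‖ ≤ C * (n.natAbs + 1 : ℝ) ^ j := by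
    intro j
    obtain ⟨C₁, h1, h1'⟩ := exists_norm_coeff_pow_le X (by rw [hX0]; exact norm_unitary_le_one U) j
    obtain ⟨C₂, h2, h2'⟩ := exists_norm_coeff_pow_le S
      (by rw [hS0, norm_star]; exact norm_unitary_le_one U) j
    refine ⟨max C₁ C₂, h1.trans (le_max_left _ _), fun n => ?_⟩
    simp only [P]
    split_ifs
    · exact (h1' _).trans (by gcongr; exact le_max_left _ _)
    · exact (h2' _).trans (by gcongr; exact le_max_right _ _)
  have hsummable : ∀ j, Summable fun n => c n • PowerSeries.coeff j (P n) := by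
    intro j
    obtain ⟨C, hC0, hC⟩ := hPn j
    refine Summable.of_norm_bounded ((hc j).mul_left C) fun n => ?_
    rw [norm_smul]
    calc ‖c n‖ * ‖PowerSeries.coeff j (P n)‖ ≤ ‖c n‖ * (C * (n.natAbs + 1 : ℝ) ^ j) := by
          gcongr; exact hC n
      _ = _ := by ring
  refine ⟨PowerSeries.mk fun j => ∑' n, c n • PowerSeries.coeff j (P n), fun j => ?_, ?_⟩
  · rw [PowerSeries.coeff_mk, PowerSeries.coeff_mk]
    refine IsCommutator.hasSum (fun n => (hP n j).smul (c n)) (hsummable j).hasSum ?_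
    have h1 := ((hsummable (j + 1)).hasSum.const_smul (j + 1 : ℂ)).neg
    refine h1.congr_fun fun n => ?_
    rw [smul_neg, smul_comm]
  · rw [PowerSeries.coeff_mk]
    have h1 := hsum.map (funCalc U) (AddMonoidHomClass.continuous_of_bound (funCalc U) 1
      fun f => by simpa using norm_funCalc_le U f)
    refine (HasSum.tsum_eq ?_)
    refine h1.congr_fun fun n => ?_
    rw [hP0, Function.comp_apply, map_smul]

end FunCalc

/-! ### Spectral projections and localization of the commutator estimate -/

section Localization

theorem inner_funCalc_mul_self (U : unitary (H →L[ℂ] H)) {f : C(Circle, ℂ)} (hf : star f = f)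
    (φ ψ : H) : ⟪funCalc U f φ, ψ⟫_ℂ = ⟪φ, funCalc U f ψ⟫_ℂ := by
  rw [← ContinuousLinearMap.adjoint_inner_right, ← ContinuousLinearMap.star_eq_adjoint,
    ← map_star, hf]

theorem spectralProj_nonneg (U : unitary (H →L[ℂ] H)) (Θ : Set Circle) :
    0 ≤ spectralProj U Θ := by
  rw [ContinuousLinearMap.nonneg_iff_isPositive, ContinuousLinearMap.isPositive_iff_complex]
  intro ψ
  have h1 := inner_spectralProj U Θ ψ
  have h2 : ⟪spectralProj U Θ ψ, ψ⟫_ℂ = ((spectralMeasure U ψ).real Θ : ℂ) := by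
    rw [← inner_conj_symm, h1, Complex.conj_ofReal]
  rw [h2]
  exact ⟨by simp, by simp⟩

theorem spectralProj_le_one (U : unitary (H →L[ℂ] H)) (Θ : Set Circle) :
    spectralProj U Θ ≤ 1 := by
  rw [ContinuousLinearMap.le_def, ContinuousLinearMap.isPositive_iff_complex]
  intro ψ
  have h1 := inner_spectralProj U Θ ψ
  have h2 : ⟪(1 - spectralProj U Θ) ψ, ψ⟫_ℂ =
      ((‖ψ‖ ^ 2 - (spectralMeasure U ψ).real Θ : ℝ) : ℂ) := by
    rw [sub_apply, inner_sub_left, ← inner_conj_symm (spectralProj U Θ ψ), h1,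
      Complex.conj_ofReal, one_apply_eq_self, inner_self_eq_norm_sq_to_K]
    push_cast
    rfl
  rw [h2]
  rw [RCLike.re_to_complex, Complex.ofReal_re]
  exact ⟨rfl, sub_nonneg.mpr (spectralMeasure_real_le U Θ ψ)⟩

theorem apply_eq_zero_of_nonneg {D : H →L[ℂ] H} (hD : 0 ≤ D) {ψ : H} (h : ⟪ψ, D ψ⟫_ℂ = 0) :
    D ψ = 0 := by
  obtain ⟨S, rfl⟩ := CStarAlgebra.nonneg_iff_eq_star_mul_self.mp hD
  rw [mul_apply_eq_comp, ContinuousLinearMap.star_eq_adjoint,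
    ContinuousLinearMap.adjoint_inner_right, inner_self_eq_zero] at h
  rw [mul_apply_eq_comp, h, map_zero]

/-- For ψ = χ(U)φ, a Urysohn function that is 1 on the support of χ and 0 off Θ shows that μ_ψ(Θ) =
‖ψ‖². Hence ⟪ψ, (1 - E_Θ)ψ⟫ = 0, and 1 - E_Θ ≥ 0 forces (1 - E_Θ)ψ = 0. Idempotence of E_Θ is not
needed. -/
theorem spectralProj_apply_funCalc (U : unitary (H →L[ℂ] H)) {Θ : Set Circle} (hΘ : IsOpen Θ)
    {χ : C(Circle, ℂ)} (hχ : tsupport χ ⊆ Θ) (φ : H) :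
    spectralProj U Θ (funCalc U χ φ) = funCalc U χ φ := by
  set ψ := funCalc U χ φ with hψ
  obtain ⟨f, hf0, hf1, hf⟩ := exists_continuous_zero_one_of_isClosed hΘ.isClosed_compl
    (isClosed_tsupport χ) (Set.disjoint_compl_left_iff_subset.mpr hχ)
  let g : C_c(Circle, ℝ) := ⟨f, HasCompactSupport.of_compactSpace f⟩
  have hg : ∀ z, g z = f z := fun z => rfl
  have h1 : toComplexFun g * χ = χ := by
    ext z
    by_cases hz : z ∈ tsupport χ
    · have : f z = 1 := hf1 hz
      simp [toComplexFun, hg, this]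
    · simp [image_eq_zero_of_notMem_tsupport hz]
  have h2 : funCalc U (toComplexFun g) ψ = ψ := by
    rw [hψ, ← mul_apply_eq_comp, ← map_mul, h1]
  have h3 := integral_spectralMeasure U ψ g
  rw [h2] at h3
  have h4 : (⟪ψ, ψ⟫_ℂ).re = ‖ψ‖ ^ 2 := inner_self_eq_norm_sq (𝕜 := ℂ) ψ
  have h5 : ∫ z, g z ∂(spectralMeasure U ψ) ≤ (spectralMeasure U ψ).real Θ := by
    rw [← MeasureTheory.integral_indicator_one hΘ.measurableSet]
    refine MeasureTheory.integral_mono g.integrable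
      ((MeasureTheory.integrable_const (1 : ℝ)).indicator hΘ.measurableSet) fun z => ?_
    by_cases hz : z ∈ Θ
    · simpa [hz, hg] using (hf z).2
    · have : f z = 0 := hf0 hz
      simp [hz, hg, this]
  have h6 : (spectralMeasure U ψ).real Θ = ‖ψ‖ ^ 2 :=
    le_antisymm (spectralMeasure_real_le U Θ ψ) (by rw [← h4, ← h3]; exact h5)
  have h7 : (1 - spectralProj U Θ) ψ = 0 := by
    refine apply_eq_zero_of_nonneg (sub_nonneg.mpr (spectralProj_le_one U Θ)) ?_
    rw [sub_apply, inner_sub_right, inner_spectralProj, h6, one_apply_eq_self,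
      inner_self_eq_norm_sq_to_K]
    simp
  rw [sub_apply, one_apply_eq_self, sub_eq_zero] at h7
  exact h7.symm

/-- The commutator estimate on vectors that are spectrally localized in `Θ`. -/
theorem re_inner_commutator_ge {U : unitary (H →L[ℂ] H)} {Θ : Set Circle} (hΘ : IsOpen Θ)
    {c : ℝ} {K C : H →L[ℂ] H}
    (h : (c : ℂ) • spectralProj U Θ + K ≤
      spectralProj U Θ * (star (U : H →L[ℂ] H) * C) * spectralProj U Θ)
    {χ : C(Circle, ℂ)} (hχ : tsupport χ ⊆ Θ) (φ : H) :
    c * ‖funCalc U χ φ‖ ^ 2 + (⟪funCalc U χ φ, K (funCalc U χ φ)⟫_ℂ).re ≤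
      (⟪(U : H →L[ℂ] H) (funCalc U χ φ), C (funCalc U χ φ)⟫_ℂ).re := by
  have hE := spectralProj_apply_funCalc U hΘ hχ φ
  set ψ := funCalc U χ φ
  rw [ContinuousLinearMap.le_def] at h
  have h1 : 0 ≤ (⟪ψ, (spectralProj U Θ * (star (U : H →L[ℂ] H) * C) * spectralProj U Θ -
      ((c : ℂ) • spectralProj U Θ + K)) ψ⟫_ℂ).re := h.re_inner_nonneg_right ψ
  have hsa : star (spectralProj U Θ) = spectralProj U Θ :=
    (IsSelfAdjoint.of_nonneg (spectralProj_nonneg U Θ)).star_eq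
  have h2 : ⟪ψ, (spectralProj U Θ * (star (U : H →L[ℂ] H) * C) * spectralProj U Θ) ψ⟫_ℂ =
      ⟪(U : H →L[ℂ] H) ψ, C ψ⟫_ℂ := by
    rw [mul_apply_eq_comp, hE, mul_apply_eq_comp, ← hsa, ContinuousLinearMap.star_eq_adjoint,
      ContinuousLinearMap.adjoint_inner_right, hE, mul_apply_eq_comp,
      ContinuousLinearMap.star_eq_adjoint, ContinuousLinearMap.adjoint_inner_right]
  have h3 : (⟪ψ, ψ⟫_ℂ).re = ‖ψ‖ ^ 2 := inner_self_eq_norm_sq (𝕜 := ℂ) ψ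
  rw [sub_apply, inner_sub_right, h2, add_apply, inner_add_right, smul_apply, hE,
    inner_smul_right, Complex.sub_re, Complex.add_re, Complex.re_ofReal_mul, h3] at h1
  linarith

/-- A smooth bump function on the circle near `l`, equal to `1` where `Re (l⁻¹ z) ≥ 1 - r` and to
`0` where `Re (l⁻¹ z) ≤ 1 - 2 r`. -/
def bump (l : Circle) (r : ℝ) : C(Circle, ℂ) where
  toFun z := ((Real.smoothTransition ((((l⁻¹ * z : Circle) : ℂ).re - (1 - 2 * r)) / r) : ℝ) : ℂ)
  continuous_toFun := by
    refine Complex.continuous_ofReal.comp (Real.smoothTransition.continuous.comp ?_)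
    exact ((Complex.continuous_re.comp (continuous_subtype_val.comp
      (continuous_const.mul continuous_id))).sub continuous_const).div_const r

theorem bump_apply (l : Circle) (r : ℝ) (z : Circle) : bump l r z =
    ((Real.smoothTransition ((((l⁻¹ * z : Circle) : ℂ).re - (1 - 2 * r)) / r) : ℝ) : ℂ) := rfl

theorem bump_eq_one {l z : Circle} {r : ℝ} (hr : 0 < r)
    (h : 1 - r ≤ ((l⁻¹ * z : Circle) : ℂ).re) : bump l r z = 1 := by
  rw [bump_apply, Real.smoothTransition.one_of_one_le, Complex.ofReal_one]
  rw [le_div_iff₀ hr]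
  linarith

theorem bump_eq_zero {l z : Circle} {r : ℝ} (hr : 0 < r)
    (h : ((l⁻¹ * z : Circle) : ℂ).re ≤ 1 - 2 * r) : bump l r z = 0 := by
  rw [bump_apply, Real.smoothTransition.zero_of_nonpos, Complex.ofReal_zero]
  exact div_nonpos_of_nonpos_of_nonneg (by linarith) hr.le

theorem contDiff_bump (l : Circle) (r : ℝ) :
    ContDiff ℝ ∞ (fun θ : ℝ => bump l r (Circle.exp θ)) := by
  have h1 : ∀ θ : ℝ, ((l⁻¹ * Circle.exp θ : Circle) : ℂ).re =
      Real.cos (θ - Complex.arg l) := by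
    intro θ
    have : l⁻¹ * Circle.exp θ = Circle.exp (θ - Complex.arg l) := by
      rw [sub_eq_neg_add, Circle.exp_add, Circle.exp_neg, Circle.exp_arg]
    rw [this, Circle.coe_exp, Complex.exp_ofReal_mul_I_re]
  simp only [bump_apply, h1]
  refine Complex.ofRealCLM.contDiff.comp (Real.smoothTransition.contDiff.comp ?_)
  exact ((Real.contDiff_cos.comp (contDiff_id.sub contDiff_const)).sub contDiff_const).div_const r

theorem norm_bump_le (l : Circle) (r : ℝ) : ‖bump l r‖ ≤ 1 := by
  rw [ContinuousMap.norm_le _ zero_le_one]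
  intro z
  rw [bump_apply, Complex.norm_real, Real.norm_of_nonneg (Real.smoothTransition.nonneg _)]
  exact Real.smoothTransition.le_one _

theorem norm_sub_sq_eq (l z : Circle) :
    ‖(z : ℂ) - l‖ ^ 2 = 2 - 2 * ((l⁻¹ * z : Circle) : ℂ).re := by
  have h1 : ‖(z : ℂ) - l‖ = ‖((l⁻¹ * z : Circle) : ℂ) - 1‖ := by
    have : (z : ℂ) - l = l * (((l⁻¹ * z : Circle) : ℂ) - 1) := by
      rw [mul_sub, ← Circle.coe_mul, mul_inv_cancel_left, mul_one]
    rw [this, norm_mul, Circle.norm_coe, one_mul]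
  set w : ℂ := ((l⁻¹ * z : Circle) : ℂ)
  have h2 : Complex.normSq w = 1 := Circle.normSq_coe _
  rw [h1, ← Complex.normSq_eq_norm_sq, Complex.normSq_sub, h2]
  simp
  ring

theorem bump_eq_zero_of_lt {l z : Circle} {r : ℝ} (hr : 0 < r)
    (h : 4 * r < ‖(z : ℂ) - l‖ ^ 2) : bump l r z = 0 := by
  rw [norm_sub_sq_eq] at h
  exact bump_eq_zero hr (by linarith)

theorem tsupport_bump_subset (l : Circle) {r : ℝ} (hr : 0 < r) :
    tsupport (bump l r) ⊆ {z : Circle | ‖(z : ℂ) - l‖ ^ 2 ≤ 4 * r} := by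
  refine closure_minimal (fun z hz => ?_) (isClosed_le (by fun_prop) continuous_const)
  by_contra h
  exact hz (bump_eq_zero_of_lt hr (not_le.mp h))

theorem eventually_tsupport_bump_subset {l : Circle} {Θ : Set Circle} (hΘ : IsOpen Θ)
    (hl : l ∈ Θ) : ∀ᶠ r in nhdsWithin (0 : ℝ) (Set.Ioi 0), tsupport (bump l r) ⊆ Θ := by
  obtain ⟨d, hd, hball⟩ := Metric.isOpen_iff.mp hΘ l hl
  have h1 : ∀ᶠ r in nhdsWithin (0 : ℝ) (Set.Ioi 0), r < d ^ 2 / 4 :=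
    nhdsWithin_le_nhds (gt_mem_nhds (by positivity))
  filter_upwards [h1, self_mem_nhdsWithin] with r hr hr0 z hz
  refine hball ?_
  have h2 : ‖(z : ℂ) - l‖ ^ 2 ≤ 4 * r := tsupport_bump_subset l hr0 hz
  have h3 : dist z l = ‖(z : ℂ) - l‖ := dist_eq_norm (z : ℂ) l
  rw [Metric.mem_ball, h3]
  exact lt_of_pow_lt_pow_left₀ 2 hd.le (by linarith)

/-- Away from the eigenvalues, spectral cutoffs tend strongly to zero. -/
theorem tendsto_funCalc_bump {U : unitary (H →L[ℂ] H)} {l : Circle} (hl : l ∉ pointSpectrum U)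
    (ψ : H) : Filter.Tendsto (fun r => funCalc U (bump l r) ψ)
      (nhdsWithin (0 : ℝ) (Set.Ioi 0)) (nhds 0) := by
  set D : H →L[ℂ] H := (U : H →L[ℂ] H) - (l : ℂ) • 1 with hD
  have hll : (l : ℂ) * (starRingEnd ℂ) l = 1 := by
    rw [← Circle.coe_inv_eq_conj, ← Circle.coe_mul, mul_inv_cancel, Circle.coe_one]
  have hdense : Dense (Set.range D) := by
    -- A vector y orthogonal to the range of U - l satisfies U*y = l̄y, and unitarity makes it an
    -- eigenvector of U for l.
    have h1 : (LinearMap.range (D : H →ₗ[ℂ] H))ᗮ = ⊥ := by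
      rw [Submodule.eq_bot_iff]
      intro y hy
      by_contra hy0
      refine hl (Module.End.hasEigenvalue_of_hasEigenvector
        (x := y) ⟨Module.End.mem_eigenspace_iff.mpr ?_, hy0⟩)
      have h2 : ContinuousLinearMap.adjoint D y = 0 := by
        refine ext_inner_right ℂ fun x => ?_
        rw [ContinuousLinearMap.adjoint_inner_left, inner_zero_left]
        exact Submodule.inner_left_of_mem_orthogonal
          (LinearMap.mem_range_self (D : H →ₗ[ℂ] H) x) hy
      have h3 : star (U : H →L[ℂ] H) y = (starRingEnd ℂ) l • y := by
        rw [← ContinuousLinearMap.star_eq_adjoint, hD, star_sub, star_smul, star_one, sub_apply,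
          sub_eq_zero] at h2
        simpa using h2
      have h4 : (U : H →L[ℂ] H) (star (U : H →L[ℂ] H) y) = y := by
        rw [← mul_apply_eq_comp, Unitary.mul_star_self_of_mem U.2, one_apply_eq_self]
      rw [h3, map_smul] at h4
      change (U : H →L[ℂ] H) y = (l : ℂ) • y
      conv_rhs => rw [← h4]
      rw [smul_smul, hll, one_smul]
    have h2 := (Submodule.topologicalClosure_eq_top_iff).mpr h1
    exact (Submodule.dense_iff_topologicalClosure_eq_top.mpr h2 :)
  have hDf : D = funCalc U (circleZPow 1 - (l : ℂ) • 1) := by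
    rw [map_sub, map_smul, map_one, funCalc_circleZPow_one]
  rw [Metric.tendsto_nhds]
  intro δ hδ
  obtain ⟨-, hx, ⟨x, rfl⟩⟩ := Metric.dense_iff.mp hdense ψ (δ / 2) (by positivity)
  -- The bump lives where |z - l| ≤ 2√r, so this bound on r makes the product of the bump with z - l
  -- small relative to x.
  have h1 : ∀ᶠ r in nhdsWithin (0 : ℝ) (Set.Ioi 0), r < (δ / (2 * (‖x‖ + 1))) ^ 2 / 4 :=
    nhdsWithin_le_nhds (gt_mem_nhds (by positivity))
  filter_upwards [h1, self_mem_nhdsWithin] with r hr hr0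
  have hr0' : 0 < r := hr0
  have h2 : ‖bump l r * (circleZPow 1 - (l : ℂ) • 1)‖ ≤ δ / (2 * (‖x‖ + 1)) := by
    rw [ContinuousMap.norm_le _ (by positivity)]
    intro z
    have hz : (bump l r * (circleZPow 1 - (l : ℂ) • 1)) z = bump l r z * ((z : ℂ) - l) := by
      simp [circleZPow]
    rw [hz, norm_mul]
    by_cases h : 4 * r < ‖(z : ℂ) - l‖ ^ 2
    · rw [bump_eq_zero_of_lt hr0' h, norm_zero, zero_mul]; positivity
    · have h3 : ‖(z : ℂ) - l‖ ≤ δ / (2 * (‖x‖ + 1)) :=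
        le_of_lt (lt_of_pow_lt_pow_left₀ 2 (by positivity) (by linarith [not_lt.mp h]))
      have h4 := ((bump l r).norm_coe_le_norm z).trans (norm_bump_le l r)
      calc _ ≤ 1 * (δ / (2 * (‖x‖ + 1))) := by gcongr
        _ = _ := one_mul _
  have h3 : ‖funCalc U (bump l r) (D x)‖ < δ / 2 := by
    rw [hDf, ← mul_apply_eq_comp, ← map_mul]
    calc _ ≤ ‖funCalc U (bump l r * (circleZPow 1 - (l : ℂ) • 1))‖ * ‖x‖ :=
          ContinuousLinearMap.le_opNorm _ _
      _ ≤ δ / (2 * (‖x‖ + 1)) * ‖x‖ := by gcongr; exact (norm_funCalc_le U _).trans h2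
      _ < δ / (2 * (‖x‖ + 1)) * (‖x‖ + 1) := by gcongr; linarith
      _ = δ / 2 := by field_simp
  have h4 : ‖funCalc U (bump l r) (ψ - D x)‖ ≤ δ / 2 := by
    have h5 : ‖ψ - D x‖ < δ / 2 := by rwa [← dist_eq_norm, dist_comm]
    calc _ ≤ ‖funCalc U (bump l r)‖ * ‖ψ - D x‖ := ContinuousLinearMap.le_opNorm _ _
      _ ≤ 1 * (δ / 2) := by
        gcongr
        exact (norm_funCalc_le U _).trans (norm_bump_le l r)
      _ = _ := one_mul _
  rw [dist_zero_right]
  calc ‖funCalc U (bump l r) ψ‖ =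
        ‖funCalc U (bump l r) (D x) + funCalc U (bump l r) (ψ - D x)‖ := by
        rw [← map_add, add_sub_cancel]
    _ ≤ _ := norm_add_le _ _
    _ < δ / 2 + δ / 2 := add_lt_add_of_lt_of_le h3 h4
    _ = δ := add_halves δ

/-- Uniformly bounded operators that tend to zero strongly do so uniformly on the relatively compact
image of the unit ball under K. This makes the compact remainder in the propagation estimate
harmless. -/
theorem eventually_norm_funCalc_bump_mul_le {U : unitary (H →L[ℂ] H)} {l : Circle}
    (hl : l ∉ pointSpectrum U) {K : H →L[ℂ] H} (hK : IsCompactOperator K) {δ : ℝ} (hδ : 0 < δ) :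
    ∀ᶠ r in nhdsWithin (0 : ℝ) (Set.Ioi 0), ‖funCalc U (bump l r) * K‖ ≤ δ := by
  have htb : TotallyBounded (K '' Metric.closedBall 0 1) :=
    (hK.isCompact_closure_image_closedBall 1).totallyBounded.subset subset_closure
  obtain ⟨t, htf, ht⟩ := Metric.totallyBounded_iff.mp htb (δ / 2) (by positivity)
  have h1 : ∀ᶠ r in nhdsWithin (0 : ℝ) (Set.Ioi 0), ∀ y ∈ t,
      ‖funCalc U (bump l r) y‖ < δ / 2 := by
    rw [htf.eventually_all]
    intro y _
    have := (Metric.tendsto_nhds.mp (tendsto_funCalc_bump hl y)) (δ / 2) (by positivity)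
    simpa only [dist_zero_right] using this
  filter_upwards [h1] with r hr
  refine ContinuousLinearMap.opNorm_le_of_unit_norm hδ.le fun x hx => ?_
  have hx' : K x ∈ ⋃ y ∈ t, Metric.ball y (δ / 2) :=
    ht ⟨x, by simp [hx], rfl⟩
  obtain ⟨y, hy, hxy⟩ := Set.mem_iUnion₂.mp hx'
  rw [Metric.mem_ball, dist_eq_norm] at hxy
  rw [mul_apply_eq_comp]
  calc ‖funCalc U (bump l r) (K x)‖ =
        ‖funCalc U (bump l r) y + funCalc U (bump l r) (K x - y)‖ := by
        rw [← map_add, add_sub_cancel]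
    _ ≤ ‖funCalc U (bump l r) y‖ + ‖funCalc U (bump l r) (K x - y)‖ := norm_add_le _ _
    _ ≤ δ / 2 + 1 * (δ / 2) := by
      gcongr
      · exact (hr y hy).le
      · refine (ContinuousLinearMap.le_opNorm _ _).trans ?_
        gcongr
        exact (norm_funCalc_le U _).trans (norm_bump_le l r)
    _ = δ := by ring

end Localization

/-! ### Contractivity of the deformation of `U χ(U)` -/

section Contraction

variable {A : H →ₗ.[ℂ] H}

theorem re_inner_eq_zero_of_star_eq_neg {S : H →L[ℂ] H} (hS : star S = -S) (ψ : H) :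
    (⟪ψ, S ψ⟫_ℂ).re = 0 := by
  have h1 : ⟪ψ, S ψ⟫_ℂ = -(starRingEnd ℂ) ⟪ψ, S ψ⟫_ℂ := by
    rw [inner_conj_symm, ← inner_neg_left, ← neg_apply, ← hS, ContinuousLinearMap.star_eq_adjoint,
      ContinuousLinearMap.adjoint_inner_left]
  have h2 := congrArg Complex.re h1
  rw [Complex.neg_re, Complex.conj_re] at h2
  linarith

/-- As 0 ≤ χ ≤ 1, the cross term is ⟪χψ, (1 - χ)ψ⟫ = ‖√(χ(1 - χ)) ψ‖² ≥ 0. -/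
theorem norm_sq_add_norm_sq_le (U : unitary (H →L[ℂ] H)) {f : Circle → ℝ} (hf : Continuous f)
    (h0 : ∀ z, 0 ≤ f z) (h1 : ∀ z, f z ≤ 1) {χ : C(Circle, ℂ)} (hχ : ∀ z, χ z = f z) (ψ : H) :
    ‖funCalc U χ ψ‖ ^ 2 + ‖ψ - funCalc U χ ψ‖ ^ 2 ≤ ‖ψ‖ ^ 2 := by
  have hs : star χ = χ := by ext z; simp [hχ]
  let g : C(Circle, ℂ) := ⟨fun z => (Real.sqrt (f z * (1 - f z)) : ℂ), by fun_prop⟩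
  have hgs : star g = g := by ext z; simp [g]
  have hg : g * g = χ * (1 - χ) := by
    ext z
    simp only [g, ContinuousMap.mul_apply, ContinuousMap.coe_mk, ContinuousMap.sub_apply,
      ContinuousMap.one_apply, hχ]
    rw [← Complex.ofReal_mul, Real.mul_self_sqrt (mul_nonneg (h0 z) (by linarith [h1 z]))]
    push_cast
    ring
  set u := funCalc U χ ψ with hu
  have h2 : ⟪u, ψ - u⟫_ℂ = ⟪funCalc U g ψ, funCalc U g ψ⟫_ℂ := by
    have : ψ - u = funCalc U (1 - χ) ψ := by
      rw [map_sub, map_one, sub_apply, one_apply_eq_self]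
    rw [this, hu, inner_funCalc_mul_self U hs, inner_funCalc_mul_self U hgs,
      ← mul_apply_eq_comp, ← mul_apply_eq_comp, ← map_mul, ← map_mul, hg]
  have h3 := norm_add_sq (𝕜 := ℂ) u (ψ - u)
  rw [add_sub_cancel, h2] at h3
  have h4 : 0 ≤ RCLike.re ⟪funCalc U g ψ, funCalc U g ψ⟫_ℂ := inner_self_nonneg
  linarith

theorem norm_unitary_apply (U : unitary (H →L[ℂ] H)) (ψ : H) : ‖(U : H →L[ℂ] H) ψ‖ = ‖ψ‖ :=
  ContinuousLinearMap.norm_map_of_mem_unitary U.2 ψ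

theorem inner_unitary_apply (U : unitary (H →L[ℂ] H)) (φ ψ : H) :
    ⟪(U : H →L[ℂ] H) φ, (U : H →L[ℂ] H) ψ⟫_ℂ = ⟪φ, ψ⟫_ℂ :=
  ContinuousLinearMap.inner_map_map_of_mem_unitary U.2 φ ψ

/-- The first order deformation of `U χ(U)` is a strict contraction. -/
theorem norm_apply_sq_le {U : unitary (H →L[ℂ] H)} {f : Circle → ℝ} (hf : Continuous f)
    (h0 : ∀ z, 0 ≤ f z) (h1 : ∀ z, f z ≤ 1) {χ : C(Circle, ℂ)} (hχ : ∀ z, χ z = f z)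
    {C S : H →L[ℂ] H} (hS : star S = -S) {c : ℝ}
    (hM : ∀ φ, c * ‖funCalc U χ φ‖ ^ 2 - c / 4 * ‖φ‖ ^ 2 ≤
      (⟪(U : H →L[ℂ] H) (funCalc U χ φ), C (funCalc U χ φ)⟫_ℂ).re)
    {ε : ℝ} (hε0 : 0 ≤ ε) (hε : 4 * c * ε ≤ 1) (ψ : H) :
    ‖((U : H →L[ℂ] H) * funCalc U χ +
        (ε : ℂ) • ((U : H →L[ℂ] H) * S - C * funCalc U χ)) ψ‖ ^ 2 ≤
      (1 - 3 / 2 * c * ε + (2 * ‖S‖ ^ 2 + ‖(U : H →L[ℂ] H) * S - C * funCalc U χ‖ ^ 2) * ε ^ 2) *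
        ‖ψ‖ ^ 2 := by
  set v := (U : H →L[ℂ] H) * S - C * funCalc U χ with hv
  set u := funCalc U χ ψ with hu
  have h2 := norm_sq_add_norm_sq_le U hf h0 h1 hχ ψ
  have h3 := hM ψ
  rw [← hu] at h2 h3
  have h4 : ((U : H →L[ℂ] H) * funCalc U χ + (ε : ℂ) • v) ψ =
      (U : H →L[ℂ] H) u + (ε : ℂ) • v ψ := rfl
  -- Skew-adjointness of S gives Re ⟪u, Sψ⟫ = -Re ⟪ψ - u, Sψ⟫, so the derivative of the cutoff is
  -- only felt by the part of ψ that the cutoff removes.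
  have h5 : (⟪(U : H →L[ℂ] H) u, v ψ⟫_ℂ).re = -(⟪ψ - u, S ψ⟫_ℂ).re -
      (⟪(U : H →L[ℂ] H) u, C u⟫_ℂ).re := by
    have h6 : v ψ = (U : H →L[ℂ] H) (S ψ) - C u := rfl
    have h7 := re_inner_eq_zero_of_star_eq_neg hS ψ
    rw [h6, inner_sub_right, inner_unitary_apply, inner_sub_left, Complex.sub_re, Complex.sub_re,
      h7]
    ring
  have h8 : -(⟪ψ - u, S ψ⟫_ℂ).re ≤ ‖ψ - u‖ * (‖S‖ * ‖ψ‖) := by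
    refine (neg_le_abs _).trans ((Complex.abs_re_le_norm _).trans ?_)
    refine (norm_inner_le_norm _ _).trans ?_
    gcongr
    exact S.le_opNorm ψ
  have h9 : ‖(ε : ℂ) • v ψ‖ ≤ ε * (‖v‖ * ‖ψ‖) := by
    rw [norm_smul, Complex.norm_real, Real.norm_of_nonneg hε0]
    gcongr
    exact v.le_opNorm ψ
  have h10 := norm_add_sq (𝕜 := ℂ) ((U : H →L[ℂ] H) u) ((ε : ℂ) • v ψ)
  rw [norm_unitary_apply, inner_smul_right, RCLike.re_to_complex, Complex.re_ofReal_mul, h5] at h10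
  have h11 : ‖(ε : ℂ) • v ψ‖ ^ 2 ≤ (ε * (‖v‖ * ‖ψ‖)) ^ 2 := by gcongr
  rw [h4, h10]
  set p := ‖u‖
  set q := ‖ψ - u‖
  set t := ‖ψ‖
  set L := ‖S‖
  have h12 : -(⟪ψ - u, S ψ⟫_ℂ).re - (⟪(U : H →L[ℂ] H) u, C u⟫_ℂ).re ≤
      q * (L * t) - (c * p ^ 2 - c / 4 * t ^ 2) := by linarith
  have h13 := mul_le_mul_of_nonneg_left h12 hε0
  -- The cross term is absorbed in half of the ‖ψ - u‖² that the cutoff loses, at a cost of second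
  -- order in ε.
  have h14 : 2 * (ε * (q * (L * t))) ≤ q ^ 2 / 2 + 2 * L ^ 2 * ε ^ 2 * t ^ 2 := by
    nlinarith [sq_nonneg (q - 2 * ε * L * t)]
  have h15 : (1 - 2 * c * ε) * p ^ 2 ≤ (1 - 2 * c * ε) * (t ^ 2 - q ^ 2) := by
    refine mul_le_mul_of_nonneg_left (by linarith) (by linarith)
  have h16 : q ^ 2 / 2 ≤ (1 - 2 * c * ε) * q ^ 2 := by
    nlinarith [mul_nonneg (sub_nonneg.mpr hε) (sq_nonneg q)]
  nlinarith

/-- The first-order part decides: it has norm at most 1 - cε/2 by the commutator estimate, and the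
terms of order at least two take away at most cε/4. -/
theorem exists_norm_truncEval_le (hA : IsSelfAdjoint A) {U : unitary (H →L[ℂ] H)}
    {f : Circle → ℝ} (hf : Continuous f) (h0 : ∀ z, 0 ≤ f z) (h1 : ∀ z, f z ≤ 1)
    {χ : C(Circle, ℂ)} (hχ : ∀ z, χ z = f z) {X Y : PowerSeries (H →L[ℂ] H)}
    (hX0 : PowerSeries.coeff 0 X = (U : H →L[ℂ] H))
    (hX1 : PowerSeries.coeff 1 X = -ad A (U : H →L[ℂ] H))
    (hY : IsTaylorSeries A Y) (hY0 : PowerSeries.coeff 0 Y = funCalc U χ) {c : ℝ} (hc : 0 < c)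
    (hM : ∀ φ, c * ‖funCalc U χ φ‖ ^ 2 - c / 4 * ‖φ‖ ^ 2 ≤
      (⟪(U : H →L[ℂ] H) (funCalc U χ φ), ad A (U : H →L[ℂ] H) (funCalc U χ φ)⟫_ℂ).re)
    {N : ℕ} (hN : 1 ≤ N) :
    ∃ ε₀ : ℝ, 0 < ε₀ ∧ ∀ ε ∈ Set.Icc 0 ε₀, ‖truncEval N (X * Y) ε‖ ≤ 1 - c / 4 * ε := by
  set S := PowerSeries.coeff 1 Y with hSdef
  -- χ(U) is self-adjoint, so its commutator with A, being unique, is skew-adjoint.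
  have hS : star S = -S := by
    have h2 : IsCommutator A (funCalc U χ) (-S) := by
      have := hY 0
      rw [hY0] at this
      simpa using this
    have hs : star χ = χ := by ext z; simp [hχ]
    have h3 := h2.star
    rw [← map_star, hs, star_neg, neg_neg] at h3
    exact h3.unique hA h2
  set C := ad A (U : H →L[ℂ] H) with hC
  set v := (U : H →L[ℂ] H) * S - C * funCalc U χ with hv
  have hZ0 : PowerSeries.coeff 0 (X * Y) = (U : H →L[ℂ] H) * funCalc U χ := by
    rw [PowerSeries.coeff_mul]
    simp [hX0, hY0]
  have hZ1 : PowerSeries.coeff 1 (X * Y) = v := by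
    rw [PowerSeries.coeff_mul, Finset.Nat.antidiagonal_succ]
    simp only [Finset.Nat.antidiagonal_zero, Finset.sum_cons, Finset.map_singleton,
      Finset.sum_singleton, Function.Embedding.prodMap, Function.Embedding.coeFn_mk, Prod.map,
      zero_add, Nat.succ_eq_add_one, Function.Embedding.refl_apply]
    rw [hX0, hX1, hY0, hv]
    noncomm_ring
  set G : ℝ := 2 * ‖S‖ ^ 2 + ‖v‖ ^ 2
  set W : ℝ := ∑ j ∈ Finset.range (N + 1), ‖PowerSeries.coeff j (X * Y)‖
  have hG0 : 0 ≤ G := by positivity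
  have hW0 : 0 ≤ W := Finset.sum_nonneg fun _ _ => norm_nonneg _
  -- In order: ε ≤ 1 bounds higher powers by ε²; 4cε ≤ 1 is required by `norm_apply_sq_le`; the
  -- third bound absorbs Gε² into cε/2; the fourth absorbs Wε² into cε/4.
  refine ⟨min (min 1 (1 / (4 * c))) (min (c / (2 * (G + 1))) (c / (4 * (W + 1)))), by positivity,
    fun ε hε => ?_⟩
  obtain ⟨hε0, hε'⟩ := hε
  simp only [le_min_iff] at hε'
  obtain ⟨⟨hε1, hε2⟩, hε3, hε4⟩ := hε'
  rw [le_div_iff₀ (by positivity)] at hε2 hε3 hε4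
  have hfirst : ‖(U : H →L[ℂ] H) * funCalc U χ + (ε : ℂ) • v‖ ≤ 1 - c / 2 * ε := by
    refine ContinuousLinearMap.opNorm_le_bound _ (by nlinarith) fun ψ => ?_
    have h2 := norm_apply_sq_le hf h0 h1 hχ hS hM hε0 (by linarith) ψ
    refine (abs_le_of_sq_le_sq' (h2.trans ?_) (mul_nonneg (by nlinarith) (norm_nonneg _))).2
    rw [mul_pow]
    gcongr
    nlinarith [sq_nonneg (c * ε), mul_le_mul_of_nonneg_right hε3 hε0]
  have hsplit : truncEval N (X * Y) ε = ((U : H →L[ℂ] H) * funCalc U χ + (ε : ℂ) • v) +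
      ∑ j ∈ Finset.range (N - 1), (ε : ℂ) ^ (j + 2) • PowerSeries.coeff (j + 2) (X * Y) := by
    obtain ⟨M, rfl⟩ : ∃ M, N = M + 1 := ⟨N - 1, by omega⟩
    rw [truncEval, Finset.sum_range_succ', Finset.sum_range_succ', Nat.add_sub_cancel, zero_add,
      hZ0, hZ1, pow_zero, pow_one, one_smul]
    abel
  have hrest : ‖∑ j ∈ Finset.range (N - 1), (ε : ℂ) ^ (j + 2) •
      PowerSeries.coeff (j + 2) (X * Y)‖ ≤ ε ^ 2 * W := by
    obtain ⟨M, rfl⟩ : ∃ M, N = M + 1 := ⟨N - 1, by omega⟩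
    rw [Nat.add_sub_cancel]
    calc _ ≤ ∑ j ∈ Finset.range M, ε ^ 2 * ‖PowerSeries.coeff (j + 2) (X * Y)‖ := by
          refine norm_sum_le_of_le _ fun j _ => ?_
          rw [norm_smul, norm_pow, Complex.norm_real, Real.norm_of_nonneg hε0]
          gcongr ?_ * _
          exact pow_le_pow_of_le_one hε0 hε1 (by omega)
      _ ≤ ε ^ 2 * W := by
        rw [← Finset.mul_sum]
        gcongr
        simp only [W]
        rw [Finset.sum_range_succ', Finset.sum_range_succ']
        have := norm_nonneg (PowerSeries.coeff (0 + 1) (X * Y))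
        have := norm_nonneg (PowerSeries.coeff 0 (X * Y))
        linarith
  rw [hsplit]
  refine (norm_add_le _ _).trans ((add_le_add hfirst hrest).trans ?_)
  nlinarith [mul_le_mul_of_nonneg_right hε4 hε0]

end Contraction

/-! ### Decay of `U ^ m Φ(U)` -/

section Main

variable {A : H →ₗ.[ℂ] H}

theorem HasDecay.add {T T' : ℕ → H →L[ℂ] H} {s q : ℝ} (h : HasDecay A T s q)
    (h' : HasDecay A T' s q) : HasDecay A (fun m => T m + T' m) s q := by
  obtain ⟨D, hD0, hD⟩ := h
  obtain ⟨D', hD0', hD'⟩ := h'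
  refine ⟨D + D', by positivity, fun m hm => ?_⟩
  rw [mul_add, add_mul, add_mul]
  exact (norm_add_le _ _).trans (add_le_add (hD m hm) (hD' m hm))

theorem hasDecay_of_mul_eq (hA : IsSelfAdjoint A) {U : unitary (H →L[ℂ] H)}
    {f : Circle → ℝ} (hf : Continuous f) (h0 : ∀ z, 0 ≤ f z) (h1 : ∀ z, f z ≤ 1)
    {χ : C(Circle, ℂ)} (hχ : ∀ z, χ z = f z)
    (hχs : ContDiff ℝ ∞ (fun θ : ℝ => χ (Circle.exp θ)))
    (hU : IsCinfty A (U : H →L[ℂ] H)) {c : ℝ} (hc : 0 < c)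
    (hM : ∀ φ, c * ‖funCalc U χ φ‖ ^ 2 - c / 4 * ‖φ‖ ^ 2 ≤
      (⟪(U : H →L[ℂ] H) (funCalc U χ φ), ad A (U : H →L[ℂ] H) (funCalc U χ φ)⟫_ℂ).re)
    {Φ : C(Circle, ℂ)} (hΦ : ContDiff ℝ ∞ (fun θ : ℝ => Φ (Circle.exp θ))) (hχΦ : χ * Φ = Φ)
    {n : ℕ} (hn : 1 ≤ n) :
    HasDecay A (fun m => (U : H →L[ℂ] H) ^ m * funCalc U Φ) (2 * n) (2 * n) := by
  obtain ⟨X, hX, hX0, hX1⟩ := hU.exists_isTaylorSeries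
  obtain ⟨Y, hY, hY0⟩ := exists_isTaylorSeries_funCalc hA hX hX0 hχs
  obtain ⟨Z, hZ, hZ0⟩ := exists_isTaylorSeries_funCalc hA hX hX0 hΦ
  obtain ⟨ε₀, hε₀, hV⟩ := exists_norm_truncEval_le hA hf h0 h1 hχ hX0 hX1 hY hY0 hc hM
    (N := 2 * n) (by omega)
  obtain ⟨D, hD0, hD⟩ := exists_norm_invSqAddOne_pow_le hA hn (hX.mul hA hY) hZ
    (by positivity : 0 < c / 4) hε₀ hV
  refine ⟨D, hD0, fun m hm => ?_⟩
  have h2 : PowerSeries.coeff 0 (X * Y) ^ m * PowerSeries.coeff 0 Z =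
      (U : H →L[ℂ] H) ^ m * funCalc U Φ := by
    have h3 : PowerSeries.coeff 0 (X * Y) = funCalc U (circleZPow 1 * χ) := by
      rw [PowerSeries.coeff_mul, map_mul, funCalc_circleZPow_one]
      simp [hX0, hY0]
    have h4 : ∀ m : ℕ, (circleZPow 1 * χ) ^ m * Φ = circleZPow 1 ^ m * Φ := by
      intro m
      rw [mul_pow, mul_assoc]
      congr 1
      induction m with
      | zero => simp
      | succ m ih => rw [pow_succ, mul_assoc, hχΦ, ih]
    rw [h3, hZ0, ← map_pow, ← map_mul, h4, map_mul, map_pow, funCalc_circleZPow_one]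
  have h5 := hD m hm
  rw [h2] at h5
  rw [bracketNegPow_two_mul hA]
  refine h5.trans (le_of_eq ?_)
  rw [Real.rpow_neg (by positivity), one_div]
  norm_cast

/-- The radius is chosen so that the bump stays inside Θ and the compact remainder is at most c/4
after cutoff; it does not depend on Φ or n. -/
theorem exists_bump_hasDecay (hA : IsSelfAdjoint A) {U : unitary (H →L[ℂ] H)}
    (hU : IsCinfty A (U : H →L[ℂ] H)) {Θ : Set Circle} (hΘ : IsOpen Θ)
    (hprop : IsPropagating A U Θ) {l : Circle} (hl : l ∈ Θ \ pointSpectrum U) :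
    ∃ r : ℝ, 0 < r ∧ ∀ Φ : C(Circle, ℂ), ContDiff ℝ ∞ (fun θ : ℝ => Φ (Circle.exp θ)) →
      bump l r * Φ = Φ → ∀ n : ℕ, 1 ≤ n →
        HasDecay A (fun m => (U : H →L[ℂ] H) ^ m * funCalc U Φ) (2 * n) (2 * n) := by
  obtain ⟨-, c, hc, K, hK, hle⟩ := hprop
  obtain ⟨r, hsupp, hKr, hr⟩ := ((eventually_tsupport_bump_subset hΘ hl.1).and
    ((eventually_norm_funCalc_bump_mul_le hl.2 hK (by positivity : 0 < c / 4)).and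
      self_mem_nhdsWithin)).exists
  refine ⟨r, hr, fun Φ hΦ hΦb n hn => hasDecay_of_mul_eq hA
    (f := fun z => Real.smoothTransition ((((l⁻¹ * z : Circle) : ℂ).re - (1 - 2 * r)) / r))
    ?_ (fun z => Real.smoothTransition.nonneg _) (fun z => Real.smoothTransition.le_one _)
    (bump_apply l r) (contDiff_bump l r) hU hc (fun φ => ?_) hΦ hΦb hn⟩
  · refine Real.smoothTransition.continuous.comp ?_
    exact ((Complex.continuous_re.comp (continuous_subtype_val.comp
      (continuous_const.mul continuous_id))).sub continuous_const).div_const r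
  · refine le_trans ?_ (re_inner_commutator_ge hΘ hle hsupp φ)
    set χ := bump l r with hχ
    have hs : star χ = χ := by
      ext z
      simp [hχ, bump_apply]
    have hn1 : ‖funCalc U χ φ‖ ≤ ‖φ‖ := by
      refine ((funCalc U χ).le_opNorm φ).trans ?_
      exact mul_le_of_le_one_left (norm_nonneg _)
        ((norm_funCalc_le U _).trans (norm_bump_le l r))
    have h1 : |(⟪funCalc U χ φ, K (funCalc U χ φ)⟫_ℂ).re| ≤ c / 4 * ‖φ‖ ^ 2 := by
      refine (Complex.abs_re_le_norm _).trans ?_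
      rw [inner_funCalc_mul_self U hs, ← mul_apply_eq_comp]
      refine (norm_inner_le_norm _ _).trans ?_
      calc ‖φ‖ * ‖(funCalc U χ * K) (funCalc U χ φ)‖
          ≤ ‖φ‖ * (c / 4 * ‖φ‖) := by
            gcongr
            refine (ContinuousLinearMap.le_opNorm _ _).trans ?_
            gcongr
        _ = _ := by ring
    linarith [neg_le_of_abs_le h1]

theorem hasDecay_funCalc_even (hA : IsSelfAdjoint A) {U : unitary (H →L[ℂ] H)}
    (hU : IsCinfty A (U : H →L[ℂ] H)) {Θ : Set Circle} (hΘ : IsOpen Θ)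
    (hprop : IsPropagating A U Θ) {Φ : C(Circle, ℂ)}
    (hΦ : IsSmoothWithSupportIn Φ (Θ \ pointSpectrum U)) {n : ℕ} (hn : 1 ≤ n) :
    HasDecay A (fun m => (U : H →L[ℂ] H) ^ m * funCalc U Φ) (2 * n) (2 * n) := by
  have hex := fun l (hl : l ∈ tsupport Φ) => exists_bump_hasDecay hA hU hΘ hprop (hΦ.2 hl)
  choose! r hr hdecay using hex
  have hopen : ∀ l : Circle,
      IsOpen {z : Circle | 1 - r l / 2 < ((l⁻¹ * z : Circle) : ℂ).re} := fun l =>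
    isOpen_lt continuous_const (Complex.continuous_re.comp (continuous_subtype_val.comp
      (continuous_const.mul continuous_id)))
  obtain ⟨t, htS, ht⟩ := (isClosed_tsupport Φ).isCompact.elim_nhds_subcover
    (fun l => {z : Circle | 1 - r l / 2 < ((l⁻¹ * z : Circle) : ℂ).re})
    (fun l hl => (hopen l).mem_nhds (by
      change 1 - r l / 2 < ((l⁻¹ * l : Circle) : ℂ).re
      have := hr l hl
      simp only [inv_mul_cancel, Circle.coe_one, Complex.one_re]
      linarith))
  -- Half the radius: β l is 1 on the covering set of l, and the full bump is 1 wherever β l is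
  -- nonzero.
  let β : Circle → C(Circle, ℂ) := fun l => bump l (r l / 2)
  have hsmooth : ∀ t : Finset Circle,
      ContDiff ℝ ∞ (fun θ : ℝ => (Φ * ∏ l ∈ t, (1 - β l)) (Circle.exp θ)) := by
    intro t
    simp only [ContinuousMap.mul_apply, ContinuousMap.coe_prod, Finset.prod_apply,
      ContinuousMap.sub_apply, ContinuousMap.one_apply]
    exact hΦ.1.mul (contDiff_prod fun l _ => contDiff_const.sub (contDiff_bump l _))
  have hβ : ∀ l ∈ tsupport Φ, bump l (r l) * β l = β l := by
    intro l hl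
    ext z
    rw [ContinuousMap.mul_apply]
    by_cases h : 1 - r l ≤ ((l⁻¹ * z : Circle) : ℂ).re
    · rw [bump_eq_one (hr l hl) h, one_mul]
    · have : β l z = 0 := bump_eq_zero (half_pos (hr l hl)) (by linarith)
      rw [this, mul_zero]
  have key : ∀ t : Finset Circle, (∀ l ∈ t, l ∈ tsupport Φ) →
      HasDecay A (fun m => (U : H →L[ℂ] H) ^ m *
        funCalc U (Φ - Φ * ∏ l ∈ t, (1 - β l))) (2 * n) (2 * n) := by
    intro t
    classical
    induction t using Finset.induction_on with
    | empty =>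
      intro _
      refine ⟨0, le_rfl, fun m _ => ?_⟩
      simp
    | insert a t ha ih =>
      intro hmem
      have h1 := ih fun l hl => hmem l (Finset.mem_insert_of_mem hl)
      have haS := hmem a (Finset.mem_insert_self a t)
      have h2 := hdecay a haS (Φ * (∏ l ∈ t, (1 - β l)) * β a)
        (by
          have := (hsmooth t).mul (contDiff_bump a (r a / 2))
          exact this)
        (by rw [mul_left_comm, hβ a haS]) n hn
      -- Telescoping: 1 - ∏ (1 - β l) is a sum of smooth pieces, each with a factor β a. On the
      -- support of Φ the product vanishes, so these pieces add up to Φ.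
      have h3 : Φ - Φ * ∏ l ∈ insert a t, (1 - β l) =
          (Φ - Φ * ∏ l ∈ t, (1 - β l)) + Φ * (∏ l ∈ t, (1 - β l)) * β a := by
        rw [Finset.prod_insert ha]
        ring
      rw [h3]
      simpa only [map_add, mul_add] using h1.add h2
  have hzero : Φ * ∏ l ∈ t, (1 - β l) = 0 := by
    ext z
    rw [ContinuousMap.mul_apply, ContinuousMap.zero_apply]
    by_cases hz : z ∈ tsupport Φ
    · obtain ⟨l, hl, hzl⟩ := Set.mem_iUnion₂.mp (ht hz)
      rw [ContinuousMap.coe_prod, Finset.prod_apply, Finset.prod_eq_zero hl, mul_zero]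
      have : β l z = 1 := bump_eq_one (half_pos (hr l (htS l hl))) (le_of_lt hzl)
      simp [this]
    · rw [image_eq_zero_of_notMem_tsupport hz, zero_mul]
  have := key t htS
  rwa [hzero, sub_zero] at this

theorem hasDecay_funCalc (hA : IsSelfAdjoint A) {U : unitary (H →L[ℂ] H)}
    (hU : IsCinfty A (U : H →L[ℂ] H)) {Θ : Set Circle} (hΘ : IsOpen Θ)
    (hprop : IsPropagating A U Θ) {Φ : C(Circle, ℂ)}
    (hΦ : IsSmoothWithSupportIn Φ (Θ \ pointSpectrum U)) {s' s : ℝ} (hs' : 0 < s')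
    (hs : s' < s) :
    HasDecay A (fun m => (U : H →L[ℂ] H) ^ m * funCalc U Φ) s s' := by
  refine hasDecay_of_forall_even (K := ‖funCalc U Φ‖) (fun m => ?_)
    (fun n hn => hasDecay_funCalc_even hA hU hΘ hprop hΦ hn) (hs'.trans hs) hs
  refine (norm_mul_le _ _).trans (mul_le_of_le_one_left (norm_nonneg _) ?_)
  exact norm_unitary_le_one (U ^ m)

theorem IsSmoothWithSupportIn.star_fun {Φ : C(Circle, ℂ)} {S : Set Circle}
    (hΦ : IsSmoothWithSupportIn Φ S) : IsSmoothWithSupportIn (star Φ) S := by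
  refine ⟨(Complex.conjCLE.contDiff.comp hΦ.1 :), ?_⟩
  have : tsupport (star Φ : C(Circle, ℂ)) = tsupport Φ := by
    refine congrArg closure (Set.ext fun z => ?_)
    simp [Function.mem_support]
  rw [this]
  exact hΦ.2

theorem rpow_neg_le_bracket_rpow {m : ℤ} (hm : m ≠ 0) {s : ℝ} (hs : 0 < s) :
    (m.natAbs : ℝ) ^ (-s) ≤ 2 ^ s * bracket m ^ (-s) := by
  have hm1 : (1 : ℝ) ≤ m.natAbs := by exact_mod_cast Int.natAbs_pos.mpr hm
  have h2 : (m : ℝ) ^ 2 = (m.natAbs : ℝ) ^ 2 := by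
    rw [Nat.cast_natAbs, Int.cast_abs, sq_abs]
  have hb : 0 < bracket m := Real.sqrt_pos.mpr (by positivity)
  have h3 : bracket m ≤ 2 * m.natAbs := by
    rw [bracket, h2, Real.sqrt_le_left (by positivity)]
    nlinarith
  have h4 : (2 * (m.natAbs : ℝ)) ^ (-s) ≤ bracket m ^ (-s) :=
    Real.rpow_le_rpow_of_nonpos hb h3 (by linarith)
  rw [Real.mul_rpow (by norm_num) (by positivity)] at h4
  calc (m.natAbs : ℝ) ^ (-s) = 2 ^ s * (2 ^ (-s) * (m.natAbs : ℝ) ^ (-s)) := by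
        rw [← mul_assoc, ← Real.rpow_add two_pos, add_neg_cancel, Real.rpow_zero, one_mul]
    _ ≤ _ := by gcongr

end Main

end UnitaryMourre

end

/-! ### The estimate for all integers `m` -/

open UnitaryMourre

theorem corollary2p4 {H : Type*} [NormedAddCommGroup H] [InnerProductSpace ℂ H] [CompleteSpace H]
    (A : H →ₗ.[ℂ] H) (hA : IsSelfAdjoint A)
    (U : unitary (H →L[ℂ] H)) (hU : UnitaryMourre.IsCinfty A (U : H →L[ℂ] H))
    (Θ : Set Circle) (hΘ : IsOpen Θ) (hprop : UnitaryMourre.IsPropagating A U Θ)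
    (Φ : C(Circle, ℂ))
    (hΦ : UnitaryMourre.IsSmoothWithSupportIn Φ (Θ \ UnitaryMourre.pointSpectrum U))
    (s' s : ℝ) (hs' : 0 < s') (hs : s' < s) :
    ∃ C : ℝ, 0 < C ∧ ∀ m : ℤ,
      ‖UnitaryMourre.bracketNegPow A s * ((U ^ m : unitary (H →L[ℂ] H)) : H →L[ℂ] H) *
          UnitaryMourre.funCalc U Φ * UnitaryMourre.bracketNegPow A s‖
        ≤ C * UnitaryMourre.bracket m ^ (-s') := by
  obtain ⟨D₁, hD₁0, hD₁⟩ := hasDecay_funCalc hA hU hΘ hprop hΦ hs' hs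
  obtain ⟨D₂, hD₂0, hD₂⟩ := hasDecay_funCalc hA hU hΘ hprop hΦ.star_fun hs' hs
  set B := bracketNegPow A s with hB
  have hBs : star B = B := (isSelfAdjoint_bracketNegPow s).star_eq
  set M := ‖B * funCalc U Φ * B‖ with hM
  have hfin : ∀ D m, 0 ≤ D → D ≤ D₁ + D₂ + M + 1 → m ≠ 0 → D * (m.natAbs : ℝ) ^ (-s') ≤
      (2 ^ s' * (D₁ + D₂ + M + 1)) * bracket m ^ (-s') := by
    intro D m hD0 hD hm
    have hb : 0 ≤ bracket m ^ (-s') := Real.rpow_nonneg (Real.sqrt_nonneg _) _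
    calc D * (m.natAbs : ℝ) ^ (-s') ≤ (D₁ + D₂ + M + 1) * (2 ^ s' * bracket m ^ (-s')) := by
          gcongr
          exact rpow_neg_le_bracket_rpow hm hs'
      _ = _ := by ring
  have hM0 : 0 ≤ M := norm_nonneg _
  -- The factor 2^{s'} comes from ⟨m⟩ ≤ 2|m| for m ≠ 0; M covers m = 0, and the 1 ensures
  -- positivity.
  refine ⟨2 ^ s' * (D₁ + D₂ + M + 1), by positivity, fun m => ?_⟩
  rcases eq_or_ne m 0 with rfl | hm
  · have h1 : bracket 0 = 1 := by simp [bracket]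
    have h2 : (1 : ℝ) ≤ 2 ^ s' := Real.one_le_rpow one_le_two hs'.le
    rw [h1, Real.one_rpow, mul_one, zpow_zero]
    simp only [OneMemClass.coe_one, mul_one]
    nlinarith
  have hm1 : 1 ≤ m.natAbs := Int.natAbs_pos.mpr hm
  rcases le_or_gt 0 m with h | h
  · have h1 : ((U ^ m : unitary (H →L[ℂ] H)) : H →L[ℂ] H) = (U : H →L[ℂ] H) ^ m.natAbs := by
      conv_lhs => rw [← Int.natAbs_of_nonneg h]
      rw [zpow_natCast, SubmonoidClass.coe_pow]
    rw [h1, mul_assoc B]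
    exact (hD₁ _ hm1).trans (hfin D₁ m hD₁0 (by linarith) hm)
  · have h1 : ((U ^ m : unitary (H →L[ℂ] H)) : H →L[ℂ] H) = star (U : H →L[ℂ] H) ^ m.natAbs := by
      have h2 : m = -(m.natAbs : ℤ) := by omega
      conv_lhs => rw [h2]
      rw [zpow_neg, zpow_natCast, ← inv_pow, SubmonoidClass.coe_pow]
      rfl
    have h3 : funCalc U Φ * star (U : H →L[ℂ] H) ^ m.natAbs =
        star (U : H →L[ℂ] H) ^ m.natAbs * funCalc U Φ := by
      rw [← funCalc_circleZPow_neg_natCast, ← map_mul, ← map_mul, mul_comm]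
    -- For m < 0, U^m Φ(U) is the adjoint of U^{|m|} Φ̄(U), and the conjugate of Φ has the same
    -- smoothness and support.
    have h4 : B * star (U : H →L[ℂ] H) ^ m.natAbs * funCalc U Φ * B =
        star (B * ((U : H →L[ℂ] H) ^ m.natAbs * funCalc U (star Φ)) * B) := by
      rw [map_star, star_mul, star_mul, star_mul, star_star, star_pow, hBs, h3]
      simp only [mul_assoc]
    rw [h1, h4, norm_star]
    exact (hD₂ _ hm1).trans (hfin D₂ m hD₂0 (by linarith) hm)
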